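/- Let $\Gamma$ be a discrete group. For a collection $\mathcal S$ of unitary representations of $\Gamma$ on complex Hilbert spaces, let $C^*_{\mathcal S}(\Gamma)$ be the (Hausdorff) completion of the group ring $\mathbb C[\Gamma]$ with respect to the $C^*$-seminorm $\|x\|_{\mathcal S}=\sup_{\pi\in\mathcal S}\|\pi(x)\|$. For $1\le p<\infty$, an $\ell^p$-representation of $\Gamma$ is a unitary representation $\pi$ on a Hilbert space $\mathcal H$ that has a dense linear subspace $\mathcal H_0$ such that the function $s\mapsto\langle\pi(s)x,x\rangle$ lies in $\ell^p(\Gamma)$ for every $x\in\mathcal H_0$, and $C^*_{\ell^p}(\Gamma)$ denotes $C^*_{\mathcal S}(\Gamma)$ with $\mathcal S$ the collection of all $\ell^p$-representations. For completions $\mathcal A,\mathcal B$ of $\mathbb C[\Gamma]$ with respect to $C^*$-seminorms, write $\mathcal A\preceq\mathcal B$ if $\|x\|_{\mathcal A}\le\|x\|_{\mathcal B}$ for every $x\in\mathbb C[\Gamma]$, and let $\mathcal A\vee\mathcal B$ be the completion of $\mathbb C[\Gamma]$ with respect to $x\mapsto\max(\|x\|_{\mathcal A},\|x\|_{\mathcal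 B})$. **Proposition.** Suppose that $\Gamma$ contains a subgroup isomorphic to the free group on two generators, and let $\mathcal F_0$ be a finite nonempty set of finite-dimensional unitary representations of $\Gamma$. Then, for all real numbers $q>p\ge 2$, $$C^*_{\ell^q}(\Gamma)\not\preceq C^*_{\mathcal F_0}(\Gamma)\vee C^*_{\ell^p}(\Gamma).$$ -/

import Mathlib

universe u v

noncomputable section

/-! ### The complex group ring as a star algebra -/

section GroupRing

variable {Γ : Type u} [Group Γ]

/-- The conjugate-linear involution of `ℂ[Γ]` determined by `(a • s)⋆ = (conj a) • s⁻¹`. -/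
def groupRingStar : MonoidAlgebra ℂ Γ →+ MonoidAlgebra ℂ Γ :=
  (Finsupp.liftAddHom (M := ℂ) fun s : Γ =>
    (MonoidAlgebra.singleAddHom s⁻¹).comp (starAddEquiv : ℂ ≃+ ℂ).toAddMonoidHom).comp
    MonoidAlgebra.coeffAddEquiv.toAddMonoidHom

theorem groupRingStar_single (s : Γ) (a : ℂ) :
    groupRingStar (MonoidAlgebra.single s a) = MonoidAlgebra.single s⁻¹ (star a) := by
  simp [groupRingStar]

theorem groupRingStar_groupRingStar (x : MonoidAlgebra ℂ Γ) :
    groupRingStar (groupRingStar x) = x := by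
  induction x using MonoidAlgebra.induction_linear with
  | zero => simp
  | add x y hx hy => simp [hx, hy]
  | single s a => simp [groupRingStar_single]

theorem groupRingStar_mul (x y : MonoidAlgebra ℂ Γ) :
    groupRingStar (x * y) = groupRingStar y * groupRingStar x := by
  induction x using MonoidAlgebra.induction_linear with
  | zero => simp
  | add x x' hx hx' => simp [add_mul, mul_add, hx, hx']
  | single s a =>
    induction y using MonoidAlgebra.induction_linear with
    | zero => simp
    | add y y' hy hy' => simp [add_mul, mul_add, hy, hy']
    | single t b =>
      simp [groupRingStar_single, MonoidAlgebra.single_mul_single, mul_comm]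

instance groupRingStarRing : StarRing (MonoidAlgebra ℂ Γ) where
  star := groupRingStar
  star_involutive := groupRingStar_groupRingStar
  star_mul := groupRingStar_mul
  star_add := map_add _

theorem star_groupRing_single (s : Γ) (a : ℂ) :
    star (MonoidAlgebra.single s a) = MonoidAlgebra.single s⁻¹ (star a) :=
  groupRingStar_single s a

instance groupRingStarModule : StarModule ℂ (MonoidAlgebra ℂ Γ) where
  star_smul c x := by
    induction x using MonoidAlgebra.induction_linear with
    | zero => simp
    | add x y hx hy => simp [hx, hy]
    | single s a => simp [star_groupRing_single]

end GroupRing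

/-! ### C⋆-seminorms on the group ring -/

/-- A C⋆-seminorm on `ℂ[Γ]`: a submultiplicative seminorm satisfying `‖x⋆ x‖ = ‖x‖ ^ 2`. -/
structure GroupCStarSeminorm (Γ : Type u) [Group Γ] extends Seminorm ℂ (MonoidAlgebra ℂ Γ) where
  mul_le' : ∀ x y, toFun (x * y) ≤ toFun x * toFun y
  star_mul_self' : ∀ x, toFun (star x * x) = toFun x ^ 2

namespace GroupCStarSeminorm

variable {Γ : Type u} [Group Γ]

theorem map_star (N : GroupCStarSeminorm Γ) (x : MonoidAlgebra ℂ Γ) :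
    N.toSeminorm (star x) = N.toSeminorm x := by
  have key : ∀ y, N.toSeminorm y ≤ N.toSeminorm (star y) := by
    intro y
    have h1 : N.toSeminorm (star y * y) = N.toSeminorm y ^ 2 := N.star_mul_self' y
    have h2 : N.toSeminorm (star y * y) ≤ N.toSeminorm (star y) * N.toSeminorm y :=
      N.mul_le' _ _
    have h3 := apply_nonneg N.toSeminorm y
    have h4 := apply_nonneg N.toSeminorm (star y)
    by_contra! h
    nlinarith
  refine le_antisymm ?_ (key x)
  simpa using key (star x)

/-- The group ring, with the topology of the C⋆-seminorm `N`. -/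
def Pre (_N : GroupCStarSeminorm Γ) : Type u := MonoidAlgebra ℂ Γ

variable (N : GroupCStarSeminorm Γ)

instance : Ring N.Pre := inferInstanceAs (Ring (MonoidAlgebra ℂ Γ))
instance : StarRing N.Pre := inferInstanceAs (StarRing (MonoidAlgebra ℂ Γ))
instance : Algebra ℂ N.Pre := inferInstanceAs (Algebra ℂ (MonoidAlgebra ℂ Γ))
instance : StarModule ℂ N.Pre := inferInstanceAs (StarModule ℂ (MonoidAlgebra ℂ Γ))

instance : SeminormedRing N.Pre :=
  { (inferInstance : Ring N.Pre),
    (N.toSeminorm.toAddGroupSeminorm.toSeminormedAddCommGroup.toPseudoMetricSpace :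
      PseudoMetricSpace (MonoidAlgebra ℂ Γ)) with
    norm := N.toSeminorm
    dist_eq := N.toSeminorm.toAddGroupSeminorm.toSeminormedAddCommGroup.dist_eq
    norm_mul_le := N.mul_le' }

theorem norm_pre (x : N.Pre) : ‖x‖ = N.toSeminorm x := rfl

instance : NormedAlgebra ℂ N.Pre :=
  { (inferInstance : Algebra ℂ N.Pre) with
    norm_smul_le := fun c x => (N.toSeminorm.smul' c x).le }

instance : NormedStarGroup N.Pre where
  norm_star_le x := (N.map_star x).le

theorem norm_star_mul_self_pre (x : N.Pre) : ‖star x * x‖ = ‖x‖ * ‖x‖ :=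
  (N.star_mul_self' x).trans (sq _)

/-- The Hausdorff completion of `ℂ[Γ]` with respect to the C⋆-seminorm `N`. -/
def Completion : Type u := UniformSpace.Completion N.Pre

instance : NormedRing N.Completion := inferInstanceAs (NormedRing (UniformSpace.Completion N.Pre))
instance : CompleteSpace N.Completion :=
  inferInstanceAs (CompleteSpace (UniformSpace.Completion N.Pre))

instance : NormedAlgebra ℂ N.Completion :=
  { (inferInstanceAs (Algebra ℂ (UniformSpace.Completion N.Pre)) : Algebra ℂ N.Completion) with
    norm_smul_le := fun c x => norm_smul_le (β := UniformSpace.Completion N.Pre) c x }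

/-- The canonical map of `ℂ[Γ]` into its completion. -/
def toCompletion (x : MonoidAlgebra ℂ Γ) : N.Completion :=
  ((show N.Pre from x : N.Pre) : UniformSpace.Completion N.Pre)

theorem norm_toCompletion (x : MonoidAlgebra ℂ Γ) : ‖N.toCompletion x‖ = N.toSeminorm x :=
  UniformSpace.Completion.norm_coe (E := N.Pre) x

theorem denseRange_toCompletion : DenseRange N.toCompletion :=
  UniformSpace.Completion.denseRange_coe (α := N.Pre)

theorem toCompletion_mul (x y : MonoidAlgebra ℂ Γ) :
    N.toCompletion (x * y) = N.toCompletion x * N.toCompletion y :=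
  UniformSpace.Completion.coe_mul (α := N.Pre) x y

theorem toCompletion_add (x y : MonoidAlgebra ℂ Γ) :
    N.toCompletion (x + y) = N.toCompletion x + N.toCompletion y :=
  UniformSpace.Completion.coe_add (α := N.Pre) x y

theorem toCompletion_smul (c : ℂ) (x : MonoidAlgebra ℂ Γ) :
    N.toCompletion (c • x) = c • N.toCompletion x :=
  UniformSpace.Completion.coe_smul (X := N.Pre) c x

theorem uniformContinuous_star_pre : UniformContinuous (star : N.Pre → N.Pre) :=
  star_isometry.uniformContinuous

/-- The involution of the completion: the continuous extension of that of `ℂ[Γ]`. -/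
instance : Star N.Completion where
  star := UniformSpace.Completion.map (star : N.Pre → N.Pre)

theorem continuous_star_completion : Continuous (star : N.Completion → N.Completion) :=
  UniformSpace.Completion.continuous_map (α := N.Pre) (β := N.Pre)

theorem toCompletion_star (x : MonoidAlgebra ℂ Γ) :
    N.toCompletion (star x) = star (N.toCompletion x) :=
  (UniformSpace.Completion.map_coe N.uniformContinuous_star_pre x).symm

instance : StarRing N.Completion where
  star_involutive x := by
    have := N.continuous_star_completion
    refine N.denseRange_toCompletion.induction_on
      (p := fun x => star (star x) = x) x (isClosed_eq (by fun_prop) (by fun_prop)) fun x => ?_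
    simp [← toCompletion_star]
  star_mul x y := by
    have := N.continuous_star_completion
    refine N.denseRange_toCompletion.induction_on₂
      (p := fun x y => star (x * y) = star y * star x)
      (isClosed_eq (by fun_prop) (by fun_prop)) (fun x y => ?_) x y
    simp [← toCompletion_star, ← toCompletion_mul]
  star_add x y := by
    have := N.continuous_star_completion
    refine N.denseRange_toCompletion.induction_on₂
      (p := fun x y => star (x + y) = star x + star y)
      (isClosed_eq (by fun_prop) (by fun_prop)) (fun x y => ?_) x y
    simp [← toCompletion_star, ← toCompletion_add]

instance : StarModule ℂ N.Completion where
  star_smul c x := by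
    have hs := N.continuous_star_completion
    have h1 : Continuous fun x : N.Completion => star (c • x) :=
      hs.comp (continuous_const_smul c)
    have h2 : Continuous fun x : N.Completion => star c • star x :=
      hs.const_smul (star c)
    refine N.denseRange_toCompletion.induction_on
      (p := fun x => star (c • x) = star c • star x) x (isClosed_eq h1 h2) fun x => ?_
    rw [← toCompletion_smul, ← toCompletion_star, ← toCompletion_star, ← toCompletion_smul]
    exact congrArg N.toCompletion (star_smul c x)

instance : CStarRing N.Completion where
  norm_mul_self_le x := by
    have := N.continuous_star_completion
    refine N.denseRange_toCompletion.induction_on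
      (p := fun x => ‖x‖ * ‖x‖ ≤ ‖star x * x‖) x
      (isClosed_le (by fun_prop) (by fun_prop)) fun x => ?_
    rw [← toCompletion_star, ← toCompletion_mul, norm_toCompletion, norm_toCompletion]
    exact (N.norm_star_mul_self_pre x).ge

instance : CStarAlgebra N.Completion where

end GroupCStarSeminorm

/-! ### Group C⋆-algebras, their order and joins -/

/-- A completion of `ℂ[Γ]` with respect to a C⋆-seminorm: a C⋆-algebra together with a
⋆-homomorphism from `ℂ[Γ]` with dense range. -/
structure GroupCStarAlgebra (Γ : Type u) [Group Γ] where
  carrier : Type u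
  [cstar : CStarAlgebra carrier]
  ι : MonoidAlgebra ℂ Γ →⋆ₐ[ℂ] carrier
  denseRange_ι : DenseRange ι

attribute [instance] GroupCStarAlgebra.cstar

namespace GroupCStarAlgebra

variable {Γ : Type u} [Group Γ]

/-- The norm `‖x‖_𝓐` of an element `x` of `ℂ[Γ]`. -/
def normOn (𝓐 : GroupCStarAlgebra Γ) (x : MonoidAlgebra ℂ Γ) : ℝ := ‖𝓐.ι x‖

/-- `𝓐 ≤ 𝓑` means `‖x‖_𝓐 ≤ ‖x‖_𝓑` for every `x` in `ℂ[Γ]`. -/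
instance : LE (GroupCStarAlgebra Γ) where
  le 𝓐 𝓑 := ∀ x : MonoidAlgebra ℂ Γ, 𝓐.normOn x ≤ 𝓑.normOn x

/-- The completion of `ℂ[Γ]` with respect to a given C⋆-seminorm. -/
def ofSeminorm (N : GroupCStarSeminorm Γ) : GroupCStarAlgebra Γ where
  carrier := N.Completion
  ι :=
    { toFun := N.toCompletion
      map_one' := UniformSpace.Completion.coe_one (α := N.Pre)
      map_mul' := N.toCompletion_mul
      map_zero' := UniformSpace.Completion.coe_zero (α := N.Pre)
      map_add' := N.toCompletion_add
      commutes' := fun c => by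
        have h1 : N.toCompletion 1 = 1 := UniformSpace.Completion.coe_one (α := N.Pre)
        rw [Algebra.algebraMap_eq_smul_one, Algebra.algebraMap_eq_smul_one, N.toCompletion_smul, h1]
      map_star' := N.toCompletion_star }
  denseRange_ι := N.denseRange_toCompletion

theorem normOn_ofSeminorm (N : GroupCStarSeminorm Γ) (x : MonoidAlgebra ℂ Γ) :
    (ofSeminorm N).normOn x = N.toSeminorm x := N.norm_toCompletion x

/-- The C⋆-seminorm `max ‖x‖_𝓐 ‖x‖_𝓑`. -/
def maxSeminorm (𝓐 𝓑 : GroupCStarAlgebra Γ) : GroupCStarSeminorm Γ where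
  toFun x := max (𝓐.normOn x) (𝓑.normOn x)
  map_zero' := by simp [normOn]
  add_le' x y := by
    simp only [normOn, map_add]
    exact max_le ((norm_add_le _ _).trans (add_le_add (le_max_left _ _) (le_max_left _ _)))
      ((norm_add_le _ _).trans (add_le_add (le_max_right _ _) (le_max_right _ _)))
  neg' x := by simp [normOn]
  smul' c x := by
    simp only [normOn, map_smul, norm_smul]
    exact (mul_max_of_nonneg _ _ (norm_nonneg c)).symm
  mul_le' x y := by
    simp only [normOn, map_mul]
    refine max_le ((norm_mul_le _ _).trans ?_) ((norm_mul_le _ _).trans ?_) <;> gcongr <;> simp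
  star_mul_self' x := by
    simp only [normOn, map_mul, map_star, CStarRing.norm_star_mul_self, ← sq]
    rcases le_total ‖𝓐.ι x‖ ‖𝓑.ι x‖ with h | h
    · rw [max_eq_right h, max_eq_right (by gcongr)]
    · rw [max_eq_left h, max_eq_left (by gcongr)]

/-- The join `𝓐 ∨ 𝓑`: the completion of `ℂ[Γ]` with respect to the larger of the two norms. -/
instance : Max (GroupCStarAlgebra Γ) where
  max 𝓐 𝓑 := ofSeminorm (maxSeminorm 𝓐 𝓑)

end GroupCStarAlgebra

/-! ### Unitary representations and the associated group C⋆-algebras -/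

/-- A unitary representation of `Γ` on a complex Hilbert space. -/
structure UnitaryRep (Γ : Type u) [Group Γ] where
  space : Type v
  [normedAddCommGroup : NormedAddCommGroup space]
  [innerProductSpace : InnerProductSpace ℂ space]
  [completeSpace : CompleteSpace space]
  hom : Γ →* unitary (space →L[ℂ] space)

attribute [instance] UnitaryRep.normedAddCommGroup UnitaryRep.innerProductSpace
  UnitaryRep.completeSpace

namespace UnitaryRep

variable {Γ : Type u} [Group Γ]

/-- The operator `π(s)`. -/
def op (π : UnitaryRep.{u, v} Γ) (s : Γ) : π.space →L[ℂ] π.space := π.hom s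

/-- The linear extension of `π` to a representation of `ℂ[Γ]`. -/
def onGroupRing (π : UnitaryRep.{u, v} Γ) :
    MonoidAlgebra ℂ Γ →ₐ[ℂ] (π.space →L[ℂ] π.space) :=
  MonoidAlgebra.lift ℂ (π.space →L[ℂ] π.space) Γ
    ((unitary (π.space →L[ℂ] π.space)).subtype.comp π.hom)

theorem onGroupRing_single (π : UnitaryRep.{u, v} Γ) (s : Γ) (a : ℂ) :
    π.onGroupRing (MonoidAlgebra.single s a) = a • π.op s := by
  simp [onGroupRing, op]

theorem onGroupRing_star (π : UnitaryRep.{u, v} Γ) (x : MonoidAlgebra ℂ Γ) :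
    π.onGroupRing (star x) = star (π.onGroupRing x) := by
  induction x using MonoidAlgebra.induction_linear with
  | zero => simp
  | add x y hx hy => simp [hx, hy]
  | single s a => simp [star_groupRing_single, onGroupRing_single, op, Unitary.star_eq_inv, ← Unitary.coe_star]

theorem norm_onGroupRing_le (π : UnitaryRep.{u, v} Γ) (x : MonoidAlgebra ℂ Γ) :
    ‖π.onGroupRing x‖ ≤ x.coeff.sum fun _ a => ‖a‖ := by
  rw [onGroupRing, MonoidAlgebra.lift_apply, Finsupp.sum, Finsupp.sum]
  refine (norm_sum_le _ _).trans (Finset.sum_le_sum fun s _ => ?_)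
  rw [norm_smul]
  refine mul_le_of_le_one_right (norm_nonneg _) ?_
  refine ContinuousLinearMap.opNorm_le_bound _ zero_le_one fun y => ?_
  simp [Unitary.norm_map]

theorem bddAbove_norm_onGroupRing (S : Set (UnitaryRep.{u, v} Γ)) (x : MonoidAlgebra ℂ Γ) :
    BddAbove (Set.range fun π : S => ‖π.1.onGroupRing x‖) :=
  ⟨_, by rintro _ ⟨π, rfl⟩; exact π.1.norm_onGroupRing_le x⟩

/-- The C⋆-seminorm `‖x‖_S = sup {‖π(x)‖ : π ∈ S}` of a collection `S` of representations. -/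
def seminormOf (S : Set (UnitaryRep.{u, v} Γ)) : GroupCStarSeminorm Γ where
  toFun x := ⨆ π : S, ‖π.1.onGroupRing x‖
  map_zero' := by simp
  add_le' x y := by
    refine Real.iSup_le (fun π => ?_) (add_nonneg (Real.iSup_nonneg fun _ => norm_nonneg _)
      (Real.iSup_nonneg fun _ => norm_nonneg _))
    rw [map_add]
    exact (norm_add_le _ _).trans (add_le_add (le_ciSup (bddAbove_norm_onGroupRing S x) π)
      (le_ciSup (bddAbove_norm_onGroupRing S y) π))
  neg' x := by simp
  smul' c x := by
    simp only [map_smul, norm_smul]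
    exact (Real.mul_iSup_of_nonneg (norm_nonneg c) _).symm
  mul_le' x y := by
    refine Real.iSup_le (fun π => ?_) (mul_nonneg (Real.iSup_nonneg fun _ => norm_nonneg _)
      (Real.iSup_nonneg fun _ => norm_nonneg _))
    rw [map_mul]
    exact (norm_mul_le _ _).trans (mul_le_mul (le_ciSup (bddAbove_norm_onGroupRing S x) π)
      (le_ciSup (bddAbove_norm_onGroupRing S y) π) (norm_nonneg _)
      (Real.iSup_nonneg fun _ => norm_nonneg _))
  star_mul_self' x := by
    simp only [map_mul, onGroupRing_star, CStarRing.norm_star_mul_self, ← sq]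
    refine le_antisymm (Real.iSup_le (fun π => ?_) (sq_nonneg _)) ?_
    · exact pow_le_pow_left₀ (norm_nonneg _) (le_ciSup (bddAbove_norm_onGroupRing S x) π) 2
    · have hb : BddAbove (Set.range fun π : S => ‖π.1.onGroupRing x‖ ^ 2) :=
        ⟨(x.coeff.sum fun _ a => ‖a‖) ^ 2, by
          rintro _ ⟨π, rfl⟩
          exact pow_le_pow_left₀ (norm_nonneg _) (π.1.norm_onGroupRing_le x) 2⟩
      rw [← Real.le_sqrt (Real.iSup_nonneg fun _ => norm_nonneg _)
        (Real.iSup_nonneg fun _ => sq_nonneg _)]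
      exact Real.iSup_le (fun π => Real.le_sqrt_of_sq_le (le_ciSup hb π)) (Real.sqrt_nonneg _)

/-- The matrix coefficient `π_{x,x}`, `s ↦ ⟨π(s) x, x⟩` (linear in `π(s) x`). -/
def diagCoeff (π : UnitaryRep.{u, v} Γ) (x : π.space) (s : Γ) : ℂ := inner ℂ x (π.op s x)

/-- `π` is a `D`-representation: for a dense linear subspace of vectors `x`, the coefficient
`π_{x,x}` lies in `D`. -/
def IsDRep (D : Set (Γ → ℂ)) (π : UnitaryRep.{u, v} Γ) : Prop :=
  ∃ H₀ : Submodule ℂ π.space, Dense (H₀ : Set π.space) ∧ ∀ x ∈ H₀, π.diagCoeff x ∈ D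

end UnitaryRep

section Completions

variable (Γ : Type u) [Group Γ]

/-- The ideal `ℓ^p(Γ)` of `ℓ^∞(Γ)`. -/
def ellP (p : ℝ) : Set (Γ → ℂ) := {f | Memℓp f (ENNReal.ofReal p)}

variable {Γ}

/-- `C⋆_S(Γ)` for a collection `S` of representations. -/
def cstarOfReps (S : Set (UnitaryRep.{u, v} Γ)) : GroupCStarAlgebra Γ :=
  GroupCStarAlgebra.ofSeminorm (UnitaryRep.seminormOf S)

/-- The ideal completion `C⋆_D(Γ)`. The supremum is taken over Hilbert spaces in the universe of
`Γ`; for translation-invariant `D`, such as `ℓ^p(Γ)`, larger ones do not change it, since it can be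
computed on cyclic subrepresentations, whose spaces are completions of quotients of `ℂ[Γ]`. -/
def cstarIdeal (D : Set (Γ → ℂ)) : GroupCStarAlgebra Γ :=
  cstarOfReps {π : UnitaryRep.{u, u} Γ | π.IsDRep D}

variable (Γ)

/-- `C⋆_{ℓ^p}(Γ)`. -/
def cstarEllP (p : ℝ) : GroupCStarAlgebra Γ := cstarIdeal (ellP Γ p)

end Completions

end

/-! The idea is to find elements of `ℂ[Γ]` that vanish in `F₀`, are small in every
`ℓ^p`-representation and are large in some `ℓ^q`-representation. A free subgroup of rank two
contains a free family `t i`, `i : ℤ`. Let `P` be a product of characteristic polynomials of the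
operators `π(t 0)`, `π ∈ F₀`, and put `y = P(t 0)`, `w = t 1 + ... + t n`, `z = star y * w * y`.
Then `z` is killed by `F₀`, and `P(0) ≠ 0` because the `π(t 0)` are invertible.

Upper bound: ping-pong shows that `w` convolves on `ℓ²(Γ)` with norm at most `2√n`, and trivially on
`ℓ¹(Γ)` with norm at most `n`. Interpolating these bounds for the powers of `star w * w`, and
pairing with an `ℓ^p` coefficient by Hölder, bounds the moments of `star w * w`; hence `‖w‖ ≤ 2
n^(1-1/p)` (`norm_sum_single_le`). The factors `y` cost a constant independent of `n`.

Lower bound: the Haagerup function `r^|s|` on the free group on `t 0, ..., t n`, extended by zero,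
is a coefficient of an `ℓ^q`-representation once `2(n+1) r^q < 1` (`exists_isDRep_of_free`). Its
value at `z` is `n r |P(r)|²` (`inner_star_mul_sum_mul`). With `r = (5n)^(-1/q)` this grows like
`|P(0)|² n^(1-1/q)`, which outgrows `n^(1-1/p)` since `q > p`. -/

open scoped ENNReal

/-! ### Free subgroups of infinite rank and coset coordinates -/

/-- A group containing a free group of rank two contains a free family indexed by `ℤ`. -/
theorem exists_injective_lift_int {Γ : Type*} [Group Γ] (f : FreeGroup (Fin 2) →* Γ)
    (hf : Function.Injective f) : ∃ t : ℤ → Γ, Function.Injective (FreeGroup.lift t) := by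
  let a : FreeGroup (Fin 2) := FreeGroup.of 0
  let b : FreeGroup (Fin 2) := FreeGroup.of 1
  refine ⟨fun i => f (b ^ i * a * (b ^ i)⁻¹), ?_⟩
  -- The conjugates `b^i a b^(-i)` are free: sending `a` to the generator `0` and `b` to the shift
  -- in `FreeGroup ℤ ⋊ ℤ` carries them to the generators `i`.
  let shift : MulAut (FreeGroup ℤ) := FreeGroup.freeGroupCongr (Equiv.addRight 1)
  have hshift : ∀ i : ℤ, (shift ^ i) (FreeGroup.of 0) = FreeGroup.of i := by
    have hs : ∀ j : ℤ, shift (FreeGroup.of j) = FreeGroup.of (j + 1) := fun j => by simp [shift]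
    have hs' : ∀ j : ℤ, shift⁻¹ (FreeGroup.of j) = FreeGroup.of (j - 1) := fun j => by
      rw [MulAut.inv_apply, MulEquiv.symm_apply_eq, hs, sub_add_cancel]
    intro i
    induction i using Int.induction_on with
    | zero => simp
    | succ n ih => rw [add_comm, zpow_add, zpow_one, MulAut.mul_apply, ih, hs, add_comm]
    | pred n ih => rw [sub_eq_neg_add, zpow_add, zpow_neg_one, MulAut.mul_apply, ih, hs',
        sub_eq_neg_add]
  let φ : Multiplicative ℤ →* MulAut (FreeGroup ℤ) := zpowersHom _ shift
  let Λ : FreeGroup (Fin 2) →* FreeGroup ℤ ⋊[φ] Multiplicative ℤ :=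
    FreeGroup.lift ![SemidirectProduct.inl (FreeGroup.of 0),
      SemidirectProduct.inr (Multiplicative.ofAdd 1)]
  have key : Λ.comp (FreeGroup.lift fun i : ℤ => b ^ i * a * (b ^ i)⁻¹) =
      SemidirectProduct.inl := by
    ext1 i
    have h := SemidirectProduct.inl_aut (φ := φ) (Multiplicative.ofAdd i) (FreeGroup.of 0)
    have hφ : φ (Multiplicative.ofAdd i) (FreeGroup.of 0) = FreeGroup.of i := by
      simp only [φ, zpowersHom_apply, toAdd_ofAdd, hshift]
    rw [hφ] at h
    have hb : SemidirectProduct.inr (φ := φ) (Multiplicative.ofAdd i) =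
        SemidirectProduct.inr (Multiplicative.ofAdd 1) ^ i := by
      rw [← map_zpow]
      congr 1
      rw [← ofAdd_zsmul]; simp
    rw [h, map_inv, hb]
    simp [Λ, a, b]
  have hinj : Function.Injective (FreeGroup.lift fun i : ℤ => b ^ i * a * (b ^ i)⁻¹) := by
    have := SemidirectProduct.inl_injective (φ := φ)
    rw [← key, MonoidHom.coe_comp] at this
    exact this.of_comp
  have : FreeGroup.lift (fun i : ℤ => f (b ^ i * a * (b ^ i)⁻¹)) =
      f.comp (FreeGroup.lift fun i : ℤ => b ^ i * a * (b ^ i)⁻¹) := by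
    ext1 i; simp
  rw [this, MonoidHom.coe_comp]
  exact hf.comp hinj

/-- Write `g` as its chosen left coset representative times `f (τ g)`; the representative is
unchanged by right multiplication by `f s`. -/
theorem exists_equivariant_section {Γ : Type*} {G : Type*} [Group Γ] [Group G] (f : G →* Γ)
    (hf : Function.Injective f) : ∃ τ : Γ → G, ∀ g s, τ (g * f s) = τ g * s := by
  have h : ∀ g : Γ, ∃ s : G, f s = ((g : Γ ⧸ f.range).out)⁻¹ * g := fun g =>
    QuotientGroup.eq.1 (QuotientGroup.out_eq' (g : Γ ⧸ f.range))
  choose τ hτ using h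
  refine ⟨τ, fun g s => hf ?_⟩
  have hc : ((g * f s : Γ) : Γ ⧸ f.range) = g :=
    QuotientGroup.mk_mul_of_mem g ⟨s, rfl⟩
  rw [hτ, hc, map_mul, hτ, mul_assoc]

/-! ### Cancellation in reduced words -/

namespace FreeGroup

variable {β : Type*} [DecidableEq β]

/-- The letter inverse to `x`. -/
abbrev invLetter (x : β × Bool) : β × Bool := (x.1, !x.2)

theorem toWord_mk_singleton_mul (x : β × Bool) (s : FreeGroup β) :
    (∃ L, s.toWord = invLetter x :: L ∧ (mk [x] * s).toWord = L) ∨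
      (s.toWord.head? ≠ some (invLetter x) ∧ (mk [x] * s).toWord = x :: s.toWord) := by
  have h : (mk [x] * s).toWord = reduce (x :: s.toWord) := by
    rw [toWord_mul, toWord_mk, reduce_singleton]; rfl
  rw [h, reduce.cons, reduce_toWord]
  rcases hs : s.toWord with _ | ⟨y, L⟩
  · simp
  · by_cases hxy : x.1 = y.1 ∧ x.2 = !y.2
    · left
      refine ⟨L, ?_, by simp [hxy]⟩
      obtain ⟨h1, h2⟩ := hxy
      have hy : y = invLetter x := Prod.ext h1.symm (by simp [h2])
      rw [hy]
    · right
      refine ⟨?_, by simp [hxy]⟩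
      rintro h
      simp only [List.head?_cons, Option.some.injEq] at h
      subst h
      simp at hxy

theorem head_toWord_of_mul {i : β} {s : FreeGroup β} (h : s.toWord.head? ≠ some (i, false)) :
    (of i * s).toWord.head? = some (i, true) := by
  rcases toWord_mk_singleton_mul (i, true) s with ⟨L, h1, -⟩ | ⟨-, h2⟩
  · simp [h1] at h
  · change (mk [(i, true)] * s).toWord.head? = _
    simp [h2]

/-- If the reduced word `x :: L` of `s` is not a suffix of that of `t`, removing `x` shortens
`s t⁻¹`. -/
theorem norm_mul_inv_of_not_suffix {x : β × Bool} {L : List (β × Bool)} {s t : FreeGroup β}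
    (hs : s.toWord = x :: L) (hst : ¬ s.toWord <:+ t.toWord) :
    norm (s * t⁻¹) = norm (mk L * t⁻¹) + 1 := by
  have hsx : s = mk [x] * mk L := by
    rw [← mk_toWord (x := s), hs, mul_mk]; rfl
  -- If `x` cancelled against `mk L * t⁻¹`, the reduced words `invRev M ++ [x]` and `x :: L` would
  -- overlap in `x` and glue to the reduced word of `t`, making the word of `s` a suffix.
  rcases toWord_mk_singleton_mul x (mk L * t⁻¹) with ⟨M, h1, -⟩ | ⟨-, h2⟩
  · exfalso
    apply hst
    have hred : IsReduced (invRev M ++ [x]) := by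
      have h : IsReduced (mk L * t⁻¹)⁻¹.toWord := isReduced_toWord
      rw [toWord_inv, h1] at h
      simpa [invRev] using h
    have hred2 : IsReduced ([x] ++ L) := by
      have h : IsReduced s.toWord := isReduced_toWord
      rwa [hs] at h
    have h3 := hred.append_overlap hred2 (by simp)
    have ht : t = mk (invRev M ++ [x] ++ L) := by
      have h4 : mk L * t⁻¹ = mk (invLetter x :: M) := by rw [← h1, mk_toWord]
      have h5 : t = (mk (invLetter x :: M))⁻¹ * mk L := by rw [← h4]; group
      rw [h5, inv_mk, mul_mk]; simp [invRev]
    rw [ht, toWord_mk, h3.reduce_eq, hs]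
    exact ⟨invRev M, by simp⟩
  · rw [hsx, mul_assoc, norm, h2, norm, List.length_cons]

/-- Distinct generators leave nothing to cancel. This additivity makes the Haagerup function
multiplicative on such products, so that sums over `a` and `b` factor. -/
theorem norm_of_pow_inv_mul_of_mul_of_pow {i k : β} (h : i ≠ k) (a b : ℕ) :
    norm ((of i ^ a)⁻¹ * (of k * of i ^ b)) = a + b + 1 := by
  have key : ((of i ^ a)⁻¹ * (of k * of i ^ b)).toWord =
      List.replicate a (i, false) ++ (k, true) :: List.replicate b (i, true) := by
    have h1 : (of i ^ a)⁻¹ * (of k * of i ^ b) =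
        mk (List.replicate a (i, false) ++ (k, true) :: List.replicate b (i, true)) := by
      rw [← mk_toWord (x := (of i ^ a)⁻¹), ← mk_toWord (x := of i ^ b), toWord_inv,
        toWord_of_pow, toWord_of_pow, of, mul_mk, mul_mk]
      simp [invRev]
    rw [h1, toWord_mk]
    apply IsReduced.reduce_eq
    rw [IsReduced, List.isChain_append]
    refine ⟨List.isChain_replicate_of_rel _ (by simp), ?_, ?_⟩
    · rw [List.isChain_cons]
      refine ⟨fun y hy => ?_, List.isChain_replicate_of_rel _ (by simp)⟩
      rw [List.head?_replicate] at hy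
      split_ifs at hy <;> simp at hy
      simp [← hy, h.symm]
    · intro x hx y hy
      have := List.eq_of_mem_replicate (List.mem_of_getLast? hx)
      simp at hy
      simp [this, ← hy, h]
  rw [norm, key]; simp; ring

end FreeGroup

/-! ### Geometric series over words -/

theorem summable_pow_length {X : Type*} [Fintype X] {ρ : ℝ} (h0 : 0 ≤ ρ)
    (h1 : Fintype.card X * ρ < 1) : Summable fun L : List X => ρ ^ L.length := by
  rw [← List.equivSigmaTuple.symm.summable_iff, summable_sigma_of_nonneg]
  · refine ⟨fun n => ?_, ?_⟩
    · exact (hasSum_fintype _).summable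
    · have : (fun n : ℕ => ∑' L : Fin n → X,
          ((fun L : List X => ρ ^ L.length) ∘ List.equivSigmaTuple.symm) ⟨n, L⟩) =
          fun n => (Fintype.card X * ρ) ^ n := by
        ext n
        simp [List.equivSigmaTuple, tsum_fintype, mul_pow]
      rw [this]
      exact summable_geometric_of_lt_one (by positivity) h1
  · intro x; simp only [Function.comp]; positivity

/-- Reduced words are counted among all words in the `2 * card β` letters, a crude bound that
suffices. -/
theorem FreeGroup.summable_pow_norm {β : Type*} [Fintype β] [DecidableEq β] {ρ : ℝ} (h0 : 0 ≤ ρ)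
    (h1 : 2 * Fintype.card β * ρ < 1) : Summable fun s : FreeGroup β => ρ ^ s.norm := by
  have : Summable fun L : List (β × Bool) => ρ ^ L.length :=
    summable_pow_length h0 (by simpa [mul_comm (2 : ℝ)] using h1)
  exact this.comp_injective FreeGroup.toWord_injective

/-! ### Positive definiteness of the Haagerup function -/

noncomputable section

variable {X : Type*}

open scoped Classical in
/-- The vectors at the vertices of a rooted tree whose Gram matrix is `r ^ dist`. -/
def treeVec (r : ℝ) : List X → lp (fun _ : List X => ℂ) 2
  | [] => lp.single 2 [] 1
  | x :: L => (r : ℂ) • treeVec r L + ((√(1 - r ^ 2) : ℝ) : ℂ) • lp.single 2 (x :: L) 1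

theorem treeVec_apply_of_not_suffix (r : ℝ) {K L : List X} (h : ¬ K <:+ L) :
    treeVec r L K = 0 := by
  classical
  induction L with
  | nil =>
    have : K ≠ [] := fun hK => h (by simp [hK])
    simp [treeVec, this]
  | cons x L ih =>
    have h1 : K ≠ x :: L := fun hK => h (by simp [hK])
    have h2 : ¬ K <:+ L := fun hK => h (hK.trans (List.suffix_cons x L))
    rw [treeVec, lp.coeFn_add, Pi.add_apply, lp.coeFn_smul, lp.coeFn_smul, Pi.smul_apply,
      Pi.smul_apply, ih h2]
    simp [h1]

/-- The basis vector added at `x :: L` is orthogonal to `treeVec r M`, which is supported on the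
suffixes of `M`. -/
theorem inner_treeVec_cons (r : ℝ) {x : X} {L M : List X} (h : ¬ (x :: L) <:+ M) :
    inner ℂ (treeVec r (x :: L)) (treeVec r M) = r * inner ℂ (treeVec r L) (treeVec r M) := by
  classical
  rw [treeVec, inner_add_left, inner_smul_left, inner_smul_left, lp.inner_single_left,
    treeVec_apply_of_not_suffix r h]
  simp

theorem inner_treeVec_self {r : ℝ} (hr : r ^ 2 ≤ 1) (L : List X) :
    inner ℂ (treeVec r L) (treeVec r L) = 1 := by
  classical
  induction L with
  | nil => simp [treeVec]
  | cons x L ih =>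
    have h : treeVec r L (x :: L) = 0 :=
      treeVec_apply_of_not_suffix r fun h => by simpa using h.length_le
    have h2 : ((√(1 - r ^ 2) : ℝ) : ℂ) * ((√(1 - r ^ 2) : ℝ) : ℂ) = 1 - r ^ 2 := by
      rw [← Complex.ofReal_mul, Real.mul_self_sqrt (by linarith)]; simp
    simp only [treeVec, inner_add_left, inner_add_right, inner_smul_left, inner_smul_right,
      lp.inner_single_left, lp.inner_single_right, ih, h]
    simp [h2]
    ring

/-- The Haagerup function `s ↦ r ^ |s|` on a free group is positive definite. -/
theorem FreeGroup.inner_treeVec {β : Type*} [DecidableEq β] {r : ℝ} (hr : r ^ 2 ≤ 1)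
    (s t : FreeGroup β) :
    inner ℂ (treeVec r s.toWord) (treeVec r t.toWord) = (r : ℂ) ^ norm (s * t⁻¹) := by
  induction hn : norm s + norm t using Nat.strong_induction_on generalizing s t with
  | _ n ih =>
    -- Deleting the first letter of `s` divides both sides by the same factor `r`. If neither word
    -- is a proper suffix of the other, or only one is, this applies to one of the two arguments
    -- unless `s = t`.
    have step : ∀ s t : FreeGroup β, norm s + norm t = n → ¬ s.toWord <:+ t.toWord →
        inner ℂ (treeVec r s.toWord) (treeVec r t.toWord) = (r : ℂ) ^ norm (s * t⁻¹) := by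
      intro s t hn hst
      rcases hs : s.toWord with _ | ⟨x, L⟩
      · simp [hs] at hst
      have hL : (mk L).toWord = L := by
        rw [toWord_mk]
        apply IsReduced.reduce_eq
        have h : IsReduced s.toWord := isReduced_toWord
        rw [hs] at h
        exact h.infix (List.suffix_cons x L).isInfix
      rw [norm_mul_inv_of_not_suffix hs hst, pow_succ', inner_treeVec_cons r (hs ▸ hst)]
      congr 1
      rw [← ih (norm (mk L) + norm t) _ (mk L) t rfl, hL]
      rw [← hn, norm, hL, norm, norm, hs]; simp
    by_cases hst : s.toWord <:+ t.toWord
    · by_cases hts : t.toWord <:+ s.toWord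
      · have : s = t := toWord_injective (hst.eq_of_length (le_antisymm hst.length_le hts.length_le))
        subst this
        rw [inner_treeVec_self hr]; simp
      · rw [← inner_conj_symm, step t s (by omega) hts, ← norm_inv_eq (x := s * t⁻¹)]
        simp
    · exact step s t hn hst

end

/-! ### Representations built from Gram matrices -/

namespace UnitaryRep

variable {Γ : Type u} [Group Γ]

theorem op_one (π : UnitaryRep.{u, v} Γ) : π.op 1 = 1 := by simp [op]

theorem op_mul (π : UnitaryRep.{u, v} Γ) (g h : Γ) : π.op (g * h) = π.op g * π.op h := by
  simp [op]

theorem op_mul_apply (π : UnitaryRep.{u, v} Γ) (g h : Γ) (x : π.space) :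
    π.op (g * h) x = π.op g (π.op h x) := by rw [op_mul]; rfl

theorem star_op (π : UnitaryRep.{u, v} Γ) (g : Γ) : star (π.op g) = π.op g⁻¹ := by
  simp [op, Unitary.star_eq_inv, ← Unitary.coe_star]

theorem inner_op_left (π : UnitaryRep.{u, v} Γ) (g : Γ) (x y : π.space) :
    inner ℂ (π.op g x) y = inner ℂ x (π.op g⁻¹ y) := by
  rw [← star_op, ContinuousLinearMap.star_eq_adjoint, ContinuousLinearMap.adjoint_inner_right]

/-- The cyclic representation with a prescribed invariant Gram matrix. -/
theorem exists_of_gram {E : Type u} [NormedAddCommGroup E] [InnerProductSpace ℂ E]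
    [CompleteSpace E] (Ξ : Γ → E)
    (hΞ : ∀ k g h, inner ℂ (Ξ (k * g)) (Ξ (k * h)) = inner ℂ (Ξ g) (Ξ h)) :
    ∃ (π : UnitaryRep.{u, u} Γ) (ξ : π.space),
      (∀ g h, inner ℂ (π.op g ξ) (π.op h ξ) = inner ℂ (Ξ g) (Ξ h)) ∧
      Dense (Submodule.span ℂ (Set.range fun g => π.op g ξ) : Set π.space) := by
  let Ψ : (Γ →₀ ℂ) →ₗ[ℂ] E := Finsupp.linearCombination ℂ Ξ
  let H : Submodule ℂ E := (LinearMap.range Ψ).topologicalClosure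
  have : CompleteSpace H := (Submodule.isClosed_topologicalClosure _).completeSpace_coe
  let e : (Γ →₀ ℂ) →ₗ[ℂ] H :=
    Ψ.codRestrict H fun x => Submodule.le_topologicalClosure _ (LinearMap.mem_range_self Ψ x)
  have he : DenseRange e := by
    rw [DenseRange, Subtype.dense_iff, ← Set.range_comp]
    intro x hx
    have : (Set.range (Subtype.val ∘ e)) = (LinearMap.range Ψ : Set E) := by
      ext; simp [e]
    change x ∈ closure (Set.range (Subtype.val ∘ e))
    rw [this]
    exact hx
  let T : Γ → (Γ →₀ ℂ) ≃ₗ[ℂ] (Γ →₀ ℂ) := fun k => Finsupp.domLCongr (Equiv.mulLeft k)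
  have hTapp : ∀ k x g, T k x g = x (k⁻¹ * g) := fun _ _ _ => rfl
  have hΨ : ∀ x y, inner ℂ (Ψ x) (Ψ y) =
      x.sum fun g a => y.sum fun h b => star a * (b * inner ℂ (Ξ g) (Ξ h)) := by
    intro x y
    simp only [Ψ, Finsupp.linearCombination_apply, Finsupp.sum, sum_inner,
      inner_smul_left]
    simp only [inner_sum, inner_smul_right, Finset.mul_sum]
    rfl
  have hT : ∀ k x, ‖e (T k x)‖ = ‖e x‖ := by
    intro k x
    have h1 : inner ℂ (Ψ (T k x)) (Ψ (T k x)) = inner ℂ (Ψ x) (Ψ x) := by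
      rw [hΨ, hΨ]
      simp only [T, Finsupp.domLCongr_apply, Finsupp.domCongr_apply, Finsupp.sum_equivMapDomain,
        Equiv.coe_mulLeft, hΞ]
    rw [inner_self_eq_norm_sq_to_K, inner_self_eq_norm_sq_to_K] at h1
    have h2 : ‖Ψ (T k x)‖ ^ 2 = ‖Ψ x‖ ^ 2 := by exact_mod_cast h1
    change ‖Ψ (T k x)‖ = ‖Ψ x‖
    exact (pow_left_inj₀ (norm_nonneg _) (norm_nonneg _) two_ne_zero).1 h2
  -- Translations preserve the Gram form, hence descend through the possibly non-injective `e` and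
  -- extend to the closure.
  let U : Γ → (H ≃ₗᵢ[ℂ] H) := fun k => (T k).extendOfIsometry e e he he (hT k)
  have hU : ∀ k x, U k (e x) = e (T k x) := fun k x =>
    LinearEquiv.extendOfIsometry_eq _ _ _ he he _ x
  have hTT : ∀ k l x, T k (T l x) = T (k * l) x := by
    intro k l x
    ext g
    rw [hTapp, hTapp, hTapp, mul_inv_rev, mul_assoc]
  let ρ : Γ →* (H ≃ₗᵢ[ℂ] H) :=
    { toFun := U
      map_one' := by
        ext1 x
        refine congrFun (he.equalizer (U 1).continuous continuous_id (funext fun y => ?_)) x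
        simp only [Function.comp, hU]
        congr 1
        ext g
        rw [hTapp, inv_one, one_mul]
      map_mul' := fun k l => by
        ext1 x
        refine congrFun (he.equalizer (U (k * l)).continuous
          ((U k).continuous.comp (U l).continuous) (funext fun y => ?_)) x
        simp only [Function.comp, hU, hTT] }
  let π : UnitaryRep.{u, u} Γ :=
    { space := H
      hom := (Unitary.linearIsometryEquiv (𝕜 := ℂ) (H := H)).symm.toMonoidHom.comp ρ }
  let ξ : H := e (Finsupp.single 1 1)
  have hop : ∀ g, π.op g ξ = e (Finsupp.single g 1) := by
    intro g
    change U g ξ = _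
    rw [hU]
    congr 1
    simp [T]
  refine ⟨π, ξ, fun g h => ?_, ?_⟩
  · rw [hop, hop]
    change inner ℂ (Ψ _) (Ψ _) = _
    simp [Ψ]
  · refine he.mono ?_
    rintro _ ⟨x, rfl⟩
    rw [← Finsupp.sum_single x, Finsupp.sum, map_sum]
    refine Submodule.sum_mem _ fun g _ => ?_
    have : e (Finsupp.single g (x g)) = x g • π.op g ξ := by
      rw [hop, ← map_smul]; simp
    rw [this]
    exact Submodule.smul_mem _ _ (Submodule.subset_span ⟨g, rfl⟩)

/-- The coefficient of `π(g) ξ` and `π(k) ξ` at `s` is that of `ξ` at `g⁻¹ s k`, a two-sided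
translate; sesquilinearity does the rest. -/
theorem memℓp_coeff_of_mem_span (π : UnitaryRep.{u, v} Γ) {p : ℝ≥0∞} (hp : 0 < p.toReal)
    {ξ : π.space} (h : Memℓp (fun s => (inner ℂ ξ (π.op s ξ) : ℂ)) p) {x y : π.space}
    (hx : x ∈ Submodule.span ℂ (Set.range fun g => π.op g ξ))
    (hy : y ∈ Submodule.span ℂ (Set.range fun g => π.op g ξ)) :
    Memℓp (fun s => (inner ℂ x (π.op s y) : ℂ)) p := by
  induction hx, hy using Submodule.span_induction₂ with
  | mem_mem x y hx hy =>
    obtain ⟨g, rfl⟩ := hx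
    obtain ⟨k, rfl⟩ := hy
    rw [memℓp_gen_iff hp] at h ⊢
    convert! h.comp_injective ((Equiv.mulLeft g⁻¹).trans (Equiv.mulRight k)).injective using 2 with s
    simp [inner_op_left, op_mul_apply]
  | zero_left y hy => simpa using zero_mem_ℓp'
  | zero_right x hx => simpa using zero_mem_ℓp'
  | add_left x y z _ _ _ h1 h2 => simp only [inner_add_left]; exact h1.add h2
  | add_right x y z _ _ _ h1 h2 => simp only [map_add, inner_add_right]; exact h1.add h2
  | smul_left c x y _ _ h1 => simp only [inner_smul_left]; exact h1.const_mul _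
  | smul_right c x y _ _ h1 => simp only [map_smul, inner_smul_right]; exact h1.const_mul c

/-- For small `r`, the Haagerup function `s ↦ r ^ |s|` of a free subgroup, extended by zero, is a
coefficient of an `ℓ^q`-representation. -/
theorem exists_isDRep_of_free {β : Type} [Fintype β] [DecidableEq β] (f : FreeGroup β →* Γ)
    (hf : Function.Injective f) {q r : ℝ} (hq : 0 < q) (hr0 : 0 ≤ r) (hr1 : r ≤ 1)
    (hr : 2 * Fintype.card β * r ^ q < 1) :
    ∃ (π : UnitaryRep.{u, u} Γ) (ξ : π.space), π.IsDRep (ellP Γ q) ∧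
      ∀ s, inner ℂ ξ (π.op (f s) ξ) = (r : ℂ) ^ s.norm := by
  classical
  obtain ⟨τ, hτ⟩ := exists_equivariant_section f hf
  -- One copy of the tree space per left coset makes different cosets orthogonal. The inverse of `τ
  -- g` turns the kernel `r ^ |s t⁻¹|` into a left-invariant one.
  let Ξ : Γ → lp (fun _ : Γ ⧸ f.range => lp (fun _ : List (β × Bool) => ℂ) 2) 2 :=
    fun g => lp.single 2 (g : Γ ⧸ f.range) (treeVec r (τ g)⁻¹.toWord)
  have hr2 : r ^ 2 ≤ 1 := pow_le_one₀ hr0 hr1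
  have hin : ∀ g s, inner ℂ (Ξ g) (Ξ (g * f s)) = (r : ℂ) ^ s.norm := by
    intro g s
    have hc : ((g * f s : Γ) : Γ ⧸ f.range) = g := QuotientGroup.mk_mul_of_mem g ⟨s, rfl⟩
    simp only [Ξ, lp.inner_single_left, hc, lp.single_apply_self]
    rw [FreeGroup.inner_treeVec hr2, hτ]
    congr 2
    group
  have hout : ∀ g h, g⁻¹ * h ∉ f.range → inner ℂ (Ξ g) (Ξ h) = (0 : ℂ) := by
    intro g h hgh
    have hc : (g : Γ ⧸ f.range) ≠ h := fun hc => hgh (QuotientGroup.eq.1 hc)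
    simp [Ξ, lp.inner_single_left, hc]
  have hval : ∀ g h, inner ℂ (Ξ g) (Ξ h) = inner ℂ (Ξ 1) (Ξ (g⁻¹ * h)) := by
    intro g h
    by_cases hgh : g⁻¹ * h ∈ f.range
    · obtain ⟨s, hs⟩ := hgh
      have h1 := hin g s
      have h2 := hin 1 s
      rw [hs] at h1 h2
      rw [one_mul] at h2
      rw [h2, ← h1, mul_inv_cancel_left]
    · rw [hout g h hgh, hout 1 _ (by simpa using hgh)]
  obtain ⟨π, ξ, hπ, hd⟩ := exists_of_gram Ξ fun k g h => by
    rw [hval (k * g), hval g]; congr 2; group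
  have hπ1 : ∀ g, inner ℂ ξ (π.op g ξ) = inner ℂ (Ξ 1) (Ξ g) := fun g => by
    rw [← hπ 1 g, op_one]; rfl
  have hfree : ∀ s, inner ℂ ξ (π.op (f s) ξ) = (r : ℂ) ^ s.norm := fun s => by
    rw [hπ1, ← hin 1 s, one_mul]
  refine ⟨π, ξ, ⟨_, hd, fun x hx => ?_⟩, hfree⟩
  have hq' : (ENNReal.ofReal q).toReal = q := ENNReal.toReal_ofReal hq.le
  refine memℓp_coeff_of_mem_span π (by rwa [hq']) ?_ hx hx
  rw [memℓp_gen_iff (by rwa [hq']), hq', ← hf.summable_iff]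
  · convert! FreeGroup.summable_pow_norm (β := β) (Real.rpow_nonneg hr0 q) hr using 2 with s
    simp only [Function.comp, hfree, norm_pow, Complex.norm_real, Real.norm_of_nonneg hr0]
    rw [← Real.rpow_natCast, ← Real.rpow_mul hr0, mul_comm, Real.rpow_mul hr0, Real.rpow_natCast]
  · intro g hg
    rw [hπ1, hout 1 g (by simpa using hg), norm_zero, Real.zero_rpow hq.ne']

end UnitaryRep

/-! ### From moments to operator norms; Hölder estimates -/

open Filter in
theorem le_of_forall_pow_two_pow_mul_le {a L c C : ℝ} (hL : 0 ≤ L) (hc : 0 < c)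
    (h : ∀ j : ℕ, a ^ 2 ^ j * c ≤ C * L ^ 2 ^ j) : a ≤ L := by
  by_contra! hlt
  have ha : 0 < a := hL.trans_lt hlt
  have h1 : Tendsto (fun j : ℕ => C * (L / a) ^ 2 ^ j) atTop (nhds (C * 0)) :=
    ((tendsto_pow_atTop_nhds_zero_of_lt_one (by positivity) ((div_lt_one ha).2 hlt)).comp
      (tendsto_pow_atTop_atTop_of_one_lt one_lt_two)).const_mul C
  rw [mul_zero] at h1
  refine hc.not_ge (ge_of_tendsto' h1 fun j => ?_)
  rw [div_pow, mul_div_assoc', le_div_iff₀ (by positivity), mul_comm]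
  exact h j

/-- A bound on the moments of a self-adjoint operator at a dense set of vectors bounds its norm. -/
theorem IsSelfAdjoint.norm_le_of_moments {H : Type*} [NormedAddCommGroup H]
    [InnerProductSpace ℂ H] [CompleteSpace H] {T : H →L[ℂ] H} (hT : IsSelfAdjoint T) {D : Set H}
    (hD : Dense D) {L : ℝ} (hL : 0 ≤ L)
    (h : ∀ x ∈ D, ∃ C : ℝ, ∀ j : ℕ, ‖(inner ℂ x ((T ^ 2 ^ j) x) : ℂ)‖ ≤ C * L ^ 2 ^ j) :
    ‖T‖ ≤ L := by
  have hsq : ∀ (j : ℕ) (x : H),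
      ‖(T ^ 2 ^ j) x‖ ^ 2 = ‖(inner ℂ x ((T ^ 2 ^ (j + 1)) x) : ℂ)‖ := by
    intro j x
    have hadj : IsSelfAdjoint (T ^ 2 ^ j) := hT.pow _
    have h1 : inner ℂ x ((T ^ 2 ^ (j + 1)) x) =
        (inner ℂ ((T ^ 2 ^ j) x) ((T ^ 2 ^ j) x) : ℂ) := by
      rw [← ContinuousLinearMap.adjoint_inner_right, hadj.adjoint_eq, pow_succ, mul_two, pow_add]
      rfl
    rw [h1, inner_self_eq_norm_sq_to_K]
    simp
  refine T.opNorm_le_bound hL fun x => ?_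
  refine hD.induction (P := fun x => ‖T x‖ ≤ L * ‖x‖) (fun x hx => ?_)
    (isClosed_le (by fun_prop) (by fun_prop)) x
  rcases eq_or_ne x 0 with rfl | hx0
  · simp
  have hxp : 0 < ‖x‖ := norm_pos_iff.2 hx0
  obtain ⟨C, hC⟩ := h x hx
  set a := ‖T x‖ / ‖x‖ with ha
  have ha0 : 0 ≤ a := by positivity
  -- Cauchy–Schwarz at each doubling keeps the growth rate at least `‖T x‖ / ‖x‖`. Comparing rates
  -- as `j → ∞` then removes the constant `C`, which may depend on `x`.
  have hconv : ∀ j : ℕ, a ^ 2 ^ j * ‖x‖ ≤ ‖(T ^ 2 ^ j) x‖ := by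
    intro j
    induction j with
    | zero => rw [ha]; simp [div_mul_cancel₀ _ hxp.ne']
    | succ j ih =>
      have h1 : (a ^ 2 ^ j * ‖x‖) ^ 2 ≤ ‖x‖ * ‖(T ^ 2 ^ (j + 1)) x‖ :=
        (pow_le_pow_left₀ (by positivity) ih 2).trans ((hsq j x).trans_le (norm_inner_le_norm _ _))
      rw [pow_succ 2, pow_mul]
      refine le_of_mul_le_mul_left ?_ hxp
      calc _ = (a ^ 2 ^ j * ‖x‖) ^ 2 := by ring
        _ ≤ _ := h1
  have : a ^ 2 ≤ L ^ 2 := by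
    refine le_of_forall_pow_two_pow_mul_le (c := ‖x‖ ^ 2) (C := C) (by positivity)
      (by positivity) fun j => ?_
    calc (a ^ 2) ^ 2 ^ j * ‖x‖ ^ 2 = (a ^ 2 ^ j * ‖x‖) ^ 2 := by ring
      _ ≤ ‖(T ^ 2 ^ j) x‖ ^ 2 := pow_le_pow_left₀ (by positivity) (hconv j) 2
      _ ≤ C * L ^ 2 ^ (j + 1) := (hsq j x).trans_le (hC (j + 1))
      _ = C * (L ^ 2) ^ 2 ^ j := by rw [← pow_mul, pow_succ']
  rwa [pow_le_pow_iff_left₀ ha0 hL two_ne_zero, ha, div_le_iff₀ hxp] at this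

/-- Hölder with weight `a` and exponent `p / 2 ≥ 1`, followed by Cauchy–Schwarz on `∑ a * b ^ (p /
2)`. -/
theorem sum_mul_le_rpow_mul_rpow {ι : Type*} (s : Finset ι) {p : ℝ} (hp : 2 ≤ p) (a b : ι → ℝ)
    (ha : ∀ i, 0 ≤ a i) (hb : ∀ i, 0 ≤ b i) :
    ∑ i ∈ s, a i * b i ≤ (∑ i ∈ s, a i) ^ (1 - 2 / p) * (∑ i ∈ s, a i ^ 2) ^ (1 / p) *
      (∑ i ∈ s, b i ^ p) ^ (1 / p) := by
  have hp0 : 0 < p := by linarith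
  have h1 := Real.inner_le_weight_mul_Lp_of_nonneg s (p := p / 2) (by linarith) a b ha hb
  have h2 : ∑ i ∈ s, a i * b i ^ (p / 2) ≤
      ((∑ i ∈ s, a i ^ 2) * (∑ i ∈ s, b i ^ p)) ^ (1 / 2 : ℝ) := by
    rw [← Real.sqrt_eq_rpow]
    refine Real.le_sqrt_of_sq_le ((Finset.sum_mul_sq_le_sq_mul_sq _ _ _).trans_eq ?_)
    congr 1
    refine Finset.sum_congr rfl fun i _ => ?_
    rw [← Real.rpow_natCast, ← Real.rpow_mul (hb i)]
    congr 1; push_cast; ring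
  have hA : 0 ≤ ∑ i ∈ s, a i ^ 2 := Finset.sum_nonneg fun i _ => sq_nonneg _
  have hB : 0 ≤ ∑ i ∈ s, b i ^ p := Finset.sum_nonneg fun i _ => Real.rpow_nonneg (hb i) _
  refine h1.trans ?_
  rw [inv_div, mul_assoc]
  refine mul_le_mul_of_nonneg_left ?_ (Real.rpow_nonneg (Finset.sum_nonneg fun i _ => ha i) _)
  refine (Real.rpow_le_rpow (Finset.sum_nonneg fun i _ =>
    mul_nonneg (ha i) (Real.rpow_nonneg (hb i) _)) h2 (by positivity)).trans_eq ?_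
  rw [← Real.rpow_mul (mul_nonneg hA hB), Real.mul_rpow hA hB]
  congr 2 <;> ring

/-! ### Ping-pong and convolution on ℓ¹ and ℓ² -/

section PingPong

variable {Γ : Type*} [Group Γ] {ι : Type*} [Fintype ι]

theorem tsum_enorm_sum_shift_le (t : ι → Γ) (h : Γ → ℂ) :
    ∑' g, ‖∑ i, h ((t i)⁻¹ * g)‖ₑ ≤ Fintype.card ι * ∑' g, ‖h g‖ₑ := by
  calc ∑' g, ‖∑ i, h ((t i)⁻¹ * g)‖ₑ ≤ ∑' g, ∑ i, ‖h ((t i)⁻¹ * g)‖ₑ :=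
        ENNReal.tsum_le_tsum fun g => enorm_sum_le _ _
    _ = ∑ i, ∑' g, ‖h ((t i)⁻¹ * g)‖ₑ := Summable.tsum_finsetSum fun _ _ => ENNReal.summable
    _ = ∑ i : ι, ∑' g, ‖h g‖ₑ :=
        Finset.sum_congr rfl fun i _ => (Equiv.mulLeft (t i)⁻¹).tsum_eq fun g => ‖h g‖ₑ
    _ = _ := by simp

theorem sq_sum_le_sum_sq_of_subsingleton (a : ι → ℝ≥0∞) (h : ∀ i j, a i ≠ 0 → a j ≠ 0 → i = j) :
    (∑ i, a i) ^ 2 ≤ ∑ i, a i ^ 2 := by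
  classical
  by_cases h0 : ∀ i, a i = 0
  · simp [h0]
  · push Not at h0
    obtain ⟨i, hi⟩ := h0
    rw [Finset.sum_eq_single i (fun j _ hj => by_contra fun hj' => hj (h j i hj' hi)) (by simp)]
    exact Finset.single_le_sum (f := fun i => a i ^ 2) (fun _ _ => zero_le) (Finset.mem_univ i)

theorem ENNReal.sq_sum_le_card_mul_sum_sq (a : ι → ℝ≥0∞) :
    (∑ i, a i) ^ 2 ≤ Fintype.card ι * ∑ i, a i ^ 2 := by
  have := ENNReal.rpow_sum_le_const_mul_sum_rpow Finset.univ a one_le_two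
  norm_num at this
  exact this

/-- Ping-pong bounds the convolution by the sum of `t i` on `ℓ²(Γ)`. -/
theorem tsum_enorm_sum_shift_sq_le (t : ι → Γ) (U V : ι → Set Γ)
    (hU : ∀ i j g, g ∈ U i → g ∈ U j → i = j) (hV : ∀ i j g, g ∈ V i → g ∈ V j → i = j)
    (hUV : ∀ i g, g ∉ V i → t i * g ∈ U i) (h : Γ → ℂ) :
    ∑' g, ‖∑ i, h ((t i)⁻¹ * g)‖ₑ ^ 2 ≤ 4 * Fintype.card ι * ∑' g, ‖h g‖ₑ ^ 2 := by
  classical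
  -- Split `h` outside and inside `V i`. The outside parts are moved into the disjoint sets `U i`,
  -- so at most one term of `∑ i, A g i` is nonzero. For the inside parts Cauchy–Schwarz costs `card
  -- ι`, but the `V i` are disjoint, so their total mass is at most that of `h`. The last `4` is `2
  -- * (1 + 1)`.
  let A : Γ → ι → ℝ≥0∞ := fun g i => (V i)ᶜ.indicator (fun k => ‖h k‖ₑ) ((t i)⁻¹ * g)
  let B : Γ → ι → ℝ≥0∞ := fun g i => (V i).indicator (fun k => ‖h k‖ₑ) ((t i)⁻¹ * g)
  have hAB : ∀ g, ‖∑ i, h ((t i)⁻¹ * g)‖ₑ ≤ ∑ i, A g i + ∑ i, B g i := by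
    intro g
    refine (enorm_sum_le _ _).trans_eq ?_
    rw [← Finset.sum_add_distrib]
    refine Finset.sum_congr rfl fun i _ => ?_
    rw [add_comm]
    exact (congrFun (Set.indicator_self_add_compl (V i) fun k => ‖h k‖ₑ) ((t i)⁻¹ * g)).symm
  have hsq : ∀ a b : ℝ≥0∞, (a + b) ^ 2 ≤ 2 * (a ^ 2 + b ^ 2) := by
    intro a b
    have := ENNReal.rpow_add_le_mul_rpow_add_rpow a b (p := 2) one_le_two
    norm_num at this
    exact this
  have hA : ∀ g, (∑ i, A g i) ^ 2 ≤ ∑ i, ‖h ((t i)⁻¹ * g)‖ₑ ^ 2 := by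
    intro g
    refine (sq_sum_le_sum_sq_of_subsingleton _ fun i j hi hj => ?_).trans
      (Finset.sum_le_sum fun i _ => ?_)
    · have key : ∀ i, A g i ≠ 0 → g ∈ U i := fun i hi => by
        have := hUV i _ (Set.mem_of_indicator_ne_zero hi)
        rwa [mul_inv_cancel_left] at this
      exact hU i j g (key i hi) (key j hj)
    · gcongr
      exact Set.indicator_le_self _ _ _
  have hA' : ∑' g, (∑ i, A g i) ^ 2 ≤ Fintype.card ι * ∑' g, ‖h g‖ₑ ^ 2 := by
    refine (ENNReal.tsum_le_tsum hA).trans_eq ?_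
    rw [Summable.tsum_finsetSum fun _ _ => ENNReal.summable]
    refine (Finset.sum_congr rfl fun i _ =>
      (Equiv.mulLeft (t i)⁻¹).tsum_eq fun g => ‖h g‖ₑ ^ 2).trans ?_
    simp
  have hB : ∑' g, (∑ i, B g i) ^ 2 ≤ Fintype.card ι * ∑' g, ‖h g‖ₑ ^ 2 := by
    calc ∑' g, (∑ i, B g i) ^ 2 ≤ ∑' g, Fintype.card ι * ∑ i, B g i ^ 2 :=
          ENNReal.tsum_le_tsum fun g => ENNReal.sq_sum_le_card_mul_sum_sq _
      _ = Fintype.card ι * ∑ i, ∑' g, B g i ^ 2 := by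
          rw [ENNReal.tsum_mul_left, Summable.tsum_finsetSum fun _ _ => ENNReal.summable]
      _ = Fintype.card ι * ∑ i, ∑' g, (V i).indicator (fun k => ‖h k‖ₑ) g ^ 2 := by
          congr 1
          exact Finset.sum_congr rfl fun i _ => (Equiv.mulLeft (t i)⁻¹).tsum_eq
            fun g => (V i).indicator (fun k => ‖h k‖ₑ) g ^ 2
      _ = Fintype.card ι * ∑' g, ∑ i, (V i).indicator (fun k => ‖h k‖ₑ) g ^ 2 := by
          rw [Summable.tsum_finsetSum fun _ _ => ENNReal.summable]
      _ ≤ _ := by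
          gcongr with g
          by_cases h0 : ∃ i, g ∈ V i
          · obtain ⟨i, hi⟩ := h0
            rw [Finset.sum_eq_single i (fun j _ hj => ?_) (by simp)]
            · simp [hi]
            · rw [Set.indicator_of_notMem fun hj' => hj (hV j i g hj' hi)]; simp
          · push Not at h0
            simp [h0]
  calc ∑' g, ‖∑ i, h ((t i)⁻¹ * g)‖ₑ ^ 2
      ≤ ∑' g, 2 * ((∑ i, A g i) ^ 2 + (∑ i, B g i) ^ 2) :=
        ENNReal.tsum_le_tsum fun g => (pow_le_pow_left' (hAB g) 2).trans (hsq _ _)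
    _ = 2 * (∑' g, (∑ i, A g i) ^ 2 + ∑' g, (∑ i, B g i) ^ 2) := by
        rw [ENNReal.tsum_mul_left, ENNReal.tsum_add]
    _ ≤ 2 * (Fintype.card ι * ∑' g, ‖h g‖ₑ ^ 2 + Fintype.card ι * ∑' g, ‖h g‖ₑ ^ 2) := by
        gcongr
    _ = _ := by ring

theorem coeff_sum_single_mul (t : ι → Γ) (x : MonoidAlgebra ℂ Γ) (g : Γ) :
    ((∑ i, MonoidAlgebra.single (t i) (1 : ℂ)) * x).coeff g = ∑ i, x.coeff ((t i)⁻¹ * g) := by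
  simp [Finset.sum_mul, MonoidAlgebra.coeff_sum, MonoidAlgebra.coeff_single_mul_apply]

theorem star_sum_single (t : ι → Γ) :
    star (∑ i, MonoidAlgebra.single (t i) (1 : ℂ)) = ∑ i, MonoidAlgebra.single (t i)⁻¹ (1 : ℂ) := by
  simp [star_groupRing_single]

/-- Each factor `star w * w` costs two convolutions. Keeping `N` abstract serves both the `ℓ¹` norm
and the squared `ℓ²` norm. -/
theorem iterate_star_mul_self_le [DecidableEq Γ] (t : ι → Γ) (N : (Γ → ℂ) → ℝ≥0∞) (c : ℝ≥0∞)
    (h1 : N (Pi.single 1 1) ≤ 1)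
    (hN : ∀ h, N (fun g => ∑ i, h ((t i)⁻¹ * g)) ≤ c * N h)
    (hN' : ∀ h, N (fun g => ∑ i, h (t i * g)) ≤ c * N h) (n : ℕ) :
    N (((star (∑ i, MonoidAlgebra.single (t i) (1 : ℂ)) *
      ∑ i, MonoidAlgebra.single (t i) (1 : ℂ)) ^ n).coeff) ≤ c ^ (2 * n) := by
  induction n with
  | zero =>
    have : ⇑(1 : MonoidAlgebra ℂ Γ).coeff = Pi.single 1 1 := by
      rw [MonoidAlgebra.one_def, MonoidAlgebra.coeff_single, Finsupp.single_eq_pi_single]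
    simpa [this] using h1
  | succ n ih =>
    rw [pow_succ', mul_assoc, star_sum_single]
    have e1 := fun (t : ι → Γ) (x : MonoidAlgebra ℂ Γ) => funext (coeff_sum_single_mul t x)
    rw [star_sum_single] at ih
    rw [e1]
    simp only [inv_inv]
    refine (hN' _).trans ?_
    rw [e1]
    calc _ ≤ c * (c * _) := by gcongr; exact hN _
      _ ≤ c * (c * c ^ (2 * n)) := by gcongr
      _ = _ := by ring

end PingPong

/-! ### The upper bound in ℓ^p-representations -/

theorem sum_le_of_tsum_ofReal_le {α : Type*} {f : α → ℝ} (hf : ∀ a, 0 ≤ f a) {c : ℝ} (hc : 0 ≤ c)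
    (h : ∑' a, ENNReal.ofReal (f a) ≤ ENNReal.ofReal c) (s : Finset α) : ∑ a ∈ s, f a ≤ c := by
  rw [← ENNReal.ofReal_le_ofReal_iff hc, ENNReal.ofReal_sum_of_nonneg fun a _ => hf a]
  exact (ENNReal.sum_le_tsum s).trans h

theorem UnitaryRep.onGroupRing_eq_sum {Γ : Type u} [Group Γ] (π : UnitaryRep.{u, v} Γ)
    (x : MonoidAlgebra ℂ Γ) : π.onGroupRing x = ∑ g ∈ x.coeff.support, x.coeff g • π.op g := by
  rw [onGroupRing, MonoidAlgebra.lift_apply, Finsupp.sum]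
  rfl

/-- Interpolation between the `ℓ¹` and `ℓ²` norms bounds the matrix coefficients of a vector with
`ℓ^p` diagonal coefficient. -/
theorem UnitaryRep.norm_inner_onGroupRing_le {Γ : Type u} [Group Γ] (π : UnitaryRep.{u, v} Γ)
    {p : ℝ} (hp : 2 ≤ p) {x : π.space} (hx : π.diagCoeff x ∈ ellP Γ p) (z : MonoidAlgebra ℂ Γ)
    {a b : ℝ} (ha : ∑ g ∈ z.coeff.support, ‖z.coeff g‖ ≤ a)
    (hb : ∑ g ∈ z.coeff.support, ‖z.coeff g‖ ^ 2 ≤ b) :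
    ‖(inner ℂ x (π.onGroupRing z x) : ℂ)‖ ≤
      (∑' g, ‖π.diagCoeff x g‖ ^ p) ^ (1 / p) * (a ^ (1 - 2 / p) * b ^ (1 / p)) := by
  have hp0 : 0 < p := by linarith
  have hp' : (ENNReal.ofReal p).toReal = p := ENNReal.toReal_ofReal hp0.le
  have hs : Summable fun g => ‖π.diagCoeff x g‖ ^ p := by
    have := Memℓp.summable (by rwa [hp']) (show Memℓp _ _ from hx)
    rwa [hp'] at this
  have h1 : ‖(inner ℂ x (π.onGroupRing z x) : ℂ)‖ ≤
      ∑ g ∈ z.coeff.support, ‖z.coeff g‖ * ‖π.diagCoeff x g‖ := by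
    rw [π.onGroupRing_eq_sum, sum_apply, inner_sum]
    refine (norm_sum_le _ _).trans_eq (Finset.sum_congr rfl fun g _ => ?_)
    rw [smul_apply, inner_smul_right, norm_mul]
    rfl
  refine h1.trans ((sum_mul_le_rpow_mul_rpow _ hp _ _ (fun _ => norm_nonneg _)
    fun _ => norm_nonneg _).trans ?_)
  have h2p : 2 / p ≤ 1 := (div_le_one hp0).2 hp
  have ha0 : 0 ≤ ∑ g ∈ z.coeff.support, ‖z.coeff g‖ := Finset.sum_nonneg fun _ _ => norm_nonneg _
  have hb0 : 0 ≤ ∑ g ∈ z.coeff.support, ‖z.coeff g‖ ^ 2 := Finset.sum_nonneg fun _ _ => sq_nonneg _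
  have hc0 : 0 ≤ ∑ g ∈ z.coeff.support, ‖π.diagCoeff x g‖ ^ p :=
    Finset.sum_nonneg fun _ _ => by positivity
  rw [mul_comm]
  have hA := Real.rpow_le_rpow ha0 ha (sub_nonneg.2 h2p)
  have hB := Real.rpow_le_rpow hb0 hb (show 0 ≤ 1 / p by positivity)
  have hC := Real.rpow_le_rpow hc0
    (hs.sum_le_tsum z.coeff.support fun _ _ => by positivity) (show 0 ≤ 1 / p by positivity)
  have hA0 := Real.rpow_nonneg ha0 (1 - 2 / p)
  have := hA0.trans hA
  have := Real.rpow_nonneg hb0 (1 / p)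
  have := Real.rpow_nonneg hc0 (1 / p)
  gcongr

/-- The powers of `m` agree exactly; the constants compare because `4 ^ (2 / p) ≤ 4` for `p ≥ 2`. -/
theorem rpow_interpolation_le {m p : ℝ} (hm : 0 < m) (hp : 2 ≤ p) (n : ℕ) :
    (m ^ (2 * n)) ^ (1 - 2 / p) * ((4 * m) ^ (2 * n)) ^ (1 / p) ≤
      ((2 * m ^ (1 - 1 / p)) ^ 2) ^ n := by
  have hp0 : 0 < p := by linarith
  have h2p : 2 / p ≤ 1 := (div_le_one hp0).2 hp
  have e1 : (m ^ (2 * n)) ^ (1 - 2 / p) = (m ^ (2 * n : ℝ)) ^ (1 - 2 / p) := by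
    rw [← Real.rpow_natCast]; push_cast; rfl
  have e2 : ((4 * m) ^ (2 * n)) ^ (1 / p) =
      ((4 : ℝ) ^ (2 / p)) ^ n * (m ^ (2 * n : ℝ)) ^ (1 / p) := by
    rw [mul_pow, Real.mul_rpow (by positivity) (by positivity)]
    congr 1
    · rw [← Real.rpow_natCast, ← Real.rpow_mul (by positivity), ← Real.rpow_natCast,
        ← Real.rpow_mul (by positivity)]
      congr 1; push_cast; ring
    · rw [← Real.rpow_natCast]; push_cast; rfl
  have e3 : ((2 * m ^ (1 - 1 / p)) ^ 2) ^ n = 4 ^ n * (m ^ (2 * n : ℝ)) ^ (1 - 1 / p) := by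
    rw [mul_pow, mul_pow]
    congr 1
    · norm_num
    · rw [← pow_mul, ← Real.rpow_natCast, ← Real.rpow_mul hm.le, ← Real.rpow_mul hm.le]
      congr 1; push_cast; ring
  rw [e1, e2, e3, mul_left_comm, ← Real.rpow_add (by positivity)]
  have e4 : 1 - 2 / p + 1 / p = 1 - 1 / p := by ring
  rw [e4]
  gcongr
  calc (4 : ℝ) ^ (2 / p) ≤ 4 ^ (1 : ℝ) := Real.rpow_le_rpow_of_exponent_le (by norm_num) h2p
    _ = 4 := by simp

/-- Ping-pong bounds the sum of the `t i` in every `ℓ^p`-representation. -/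
theorem UnitaryRep.IsDRep.norm_sum_single_le {Γ : Type u} [Group Γ] {ι : Type*} [Fintype ι]
    [Nonempty ι] (t : ι → Γ) (U V : ι → Set Γ)
    (hU : ∀ i j g, g ∈ U i → g ∈ U j → i = j) (hV : ∀ i j g, g ∈ V i → g ∈ V j → i = j)
    (hUV : ∀ i g, g ∉ V i → t i * g ∈ U i) {p : ℝ} (hp : 2 ≤ p) {π : UnitaryRep.{u, v} Γ}
    (hπ : π.IsDRep (ellP Γ p)) :
    ‖π.onGroupRing (∑ i, MonoidAlgebra.single (t i) (1 : ℂ))‖ ≤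
      2 * (Fintype.card ι : ℝ) ^ (1 - 1 / p) := by
  classical
  -- The inverses play ping-pong with `U` and `V` exchanged, which handles `star w`.
  have hVU : ∀ i g, g ∉ U i → (t i)⁻¹ * g ∈ V i := fun i g hg => by
    by_contra hg'
    exact hg (by simpa using hUV i _ hg')
  set w : MonoidAlgebra ℂ Γ := ∑ i, MonoidAlgebra.single (t i) (1 : ℂ) with hw
  set m : ℝ := (Fintype.card ι : ℝ) with hm
  have hm0 : 0 < m := Nat.cast_pos.2 Fintype.card_pos
  have ofReal_m : ENNReal.ofReal m = Fintype.card ι := ENNReal.ofReal_natCast _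
  have hone : ∀ (n : ℕ) (s : Finset Γ), ∑ g ∈ s, ‖((star w * w) ^ n).coeff g‖ ≤ m ^ (2 * n) := by
    intro n s
    refine sum_le_of_tsum_ofReal_le (fun _ => norm_nonneg _) (by positivity) ?_ s
    simp only [ofReal_norm]
    rw [ENNReal.ofReal_pow hm0.le, ofReal_m]
    refine iterate_star_mul_self_le t (fun h => ∑' g, ‖h g‖ₑ) _ ?_
      (tsum_enorm_sum_shift_le t) (fun h => ?_) n
    · rw [tsum_eq_single 1 fun g hg => by simp [hg]]; simp
    · simpa using tsum_enorm_sum_shift_le (fun i => (t i)⁻¹) h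
  have htwo : ∀ (n : ℕ) (s : Finset Γ),
      ∑ g ∈ s, ‖((star w * w) ^ n).coeff g‖ ^ 2 ≤ (4 * m) ^ (2 * n) := by
    intro n s
    refine sum_le_of_tsum_ofReal_le (fun _ => sq_nonneg _) (by positivity) ?_ s
    simp only [ENNReal.ofReal_pow (norm_nonneg _), ofReal_norm]
    rw [ENNReal.ofReal_pow (by positivity), ENNReal.ofReal_mul (by norm_num), ofReal_m,
      ENNReal.ofReal_ofNat]
    refine iterate_star_mul_self_le t (fun h => ∑' g, ‖h g‖ₑ ^ 2) _ ?_
      (tsum_enorm_sum_shift_sq_le t U V hU hV hUV) (fun h => ?_) n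
    · rw [tsum_eq_single 1 fun g hg => by simp [hg]]; simp
    · simpa using tsum_enorm_sum_shift_sq_le (fun i => (t i)⁻¹) V U hV hU hVU h
  obtain ⟨H₀, hd, hH⟩ := hπ
  have hsa : IsSelfAdjoint (π.onGroupRing (star w * w)) := by
    rw [map_mul, π.onGroupRing_star]
    exact IsSelfAdjoint.star_mul_self _
  have key : ‖π.onGroupRing (star w * w)‖ ≤ (2 * m ^ (1 - 1 / p)) ^ 2 := by
    refine hsa.norm_le_of_moments hd (by positivity) fun x hx =>
      ⟨(∑' g, ‖π.diagCoeff x g‖ ^ p) ^ (1 / p), fun j => ?_⟩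
    rw [← map_pow]
    refine (π.norm_inner_onGroupRing_le hp (hH x hx) _ (hone _ _) (htwo _ _)).trans ?_
    refine mul_le_mul_of_nonneg_left (rpow_interpolation_le hm0 hp _) ?_
    exact Real.rpow_nonneg (tsum_nonneg fun _ => by positivity) _
  rw [map_mul, π.onGroupRing_star, CStarRing.norm_star_mul_self, ← sq] at key
  exact (pow_le_pow_iff_left₀ (norm_nonneg _) (by positivity) two_ne_zero).1 key

/-! ### Annihilating finite-dimensional representations; evaluation on free generators -/

namespace UnitaryRep

variable {Γ : Type u} [Group Γ]

/-- Cayley–Hamilton for each representation, then the product. The constant terms are determinants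
of invertible operators up to sign; `P(0) ≠ 0` matters because `P` is later evaluated at `r → 0`. -/
theorem exists_annihilating_polynomial (F₀ : Set (UnitaryRep.{u, v} Γ)) (hfin : F₀.Finite)
    (hfd : ∀ π ∈ F₀, FiniteDimensional ℂ π.space) (a : Γ) :
    ∃ P : Polynomial ℂ, P.eval 0 ≠ 0 ∧ ∀ π ∈ F₀, Polynomial.aeval (π.op a) P = 0 := by
  have h : ∀ π : UnitaryRep.{u, v} Γ, ∃ Q : Polynomial ℂ, π ∈ F₀ →
      Q.eval 0 ≠ 0 ∧ Polynomial.aeval (π.op a) Q = 0 := by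
    intro π
    by_cases hπ : π ∈ F₀
    swap
    · exact ⟨0, fun h => absurd h hπ⟩
    have := hfd π hπ
    let A : Module.End ℂ π.space := (π.op a).toLinearMap
    refine ⟨A.charpoly, fun _ => ⟨?_, ?_⟩⟩
    · have hu : IsUnit A := by
        refine ⟨⟨A, (π.op a⁻¹).toLinearMap, ?_, ?_⟩, rfl⟩ <;>
        · ext x
          change π.op _ (π.op _ x) = x
          rw [← op_mul_apply]; simp [op_one]
      have hdet : LinearMap.det A ≠ 0 := (hu.map LinearMap.det).ne_zero
      rw [LinearMap.det_eq_sign_charpoly_coeff] at hdet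
      rw [← Polynomial.coeff_zero_eq_eval_zero]
      exact right_ne_zero_of_mul hdet
    · have h1 := LinearMap.aeval_self_charpoly A
      have h2 : ∀ Q : Polynomial ℂ,
          (Polynomial.aeval (π.op a) Q).toLinearMap = Polynomial.aeval A Q := fun Q =>
        (Polynomial.aeval_algHom_apply
          ({ ContinuousLinearMap.toLinearMapRingHom (R₁ := ℂ) (M₁ := π.space) with
            commutes' := fun _ => rfl } :
              (π.space →L[ℂ] π.space) →ₐ[ℂ] (π.space →ₗ[ℂ] π.space)) (π.op a) Q).symm
      apply ContinuousLinearMap.coe_injective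
      rw [h2, h1]; rfl
  choose Q hQ using h
  refine ⟨∏ π ∈ hfin.toFinset, Q π, ?_, fun π hπ => ?_⟩
  · rw [Polynomial.eval_prod, Finset.prod_ne_zero_iff]
    exact fun π hπ => (hQ π (hfin.mem_toFinset.1 hπ)).1
  · obtain ⟨R, hR⟩ := Finset.dvd_prod_of_mem Q (hfin.mem_toFinset.2 hπ)
    rw [hR, map_mul, (hQ π hπ).2, zero_mul]

theorem onGroupRing_aeval_single (π : UnitaryRep.{u, v} Γ) (a : Γ) (P : Polynomial ℂ) :
    π.onGroupRing (Polynomial.aeval (MonoidAlgebra.single a (1 : ℂ)) P) =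
      Polynomial.aeval (π.op a) P := by
  rw [← Polynomial.aeval_algHom_apply, onGroupRing_single, one_smul]

theorem aeval_op_apply (π : UnitaryRep.{u, v} Γ) (a : Γ) (P : Polynomial ℂ) (x : π.space) :
    Polynomial.aeval (π.op a) P x =
      ∑ i ∈ Finset.range (P.natDegree + 1), P.coeff i • π.op (a ^ i) x := by
  have hpow : ∀ i : ℕ, π.op a ^ i = π.op (a ^ i) := fun i => by simp [op]
  simp [Polynomial.aeval_eq_sum_range, sum_apply, hpow]

/-- Free generators satisfy ping-pong for the left multiplication action. -/
theorem norm_sum_free_generators_le {κ ι : Type*} [Fintype ι] [Nonempty ι] [DecidableEq κ]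
    (t : κ → Γ) (ht : Function.Injective (FreeGroup.lift t)) (k : ι → κ)
    (hk : Function.Injective k) {p : ℝ} (hp : 2 ≤ p) {π : UnitaryRep.{u, v} Γ}
    (hπ : π.IsDRep (ellP Γ p)) :
    ‖π.onGroupRing (∑ i, MonoidAlgebra.single (t (k i)) (1 : ℂ))‖ ≤
      2 * (Fintype.card ι : ℝ) ^ (1 - 1 / p) := by
  obtain ⟨τ, hτ⟩ := exists_equivariant_section (FreeGroup.lift t) ht
  -- Inverting twice makes `τ` equivariant for left multiplication; the ping-pong sets prescribe the
  -- first letter of this coordinate.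
  let S : Bool → ι → Set Γ := fun b i => {g | (τ g⁻¹)⁻¹.toWord.head? = some (k i, b)}
  have hS : ∀ b i j g, g ∈ S b i → g ∈ S b j → i = j := by
    intro b i j g hi hj
    have : some (k i, b) = some (k j, b) := Eq.trans (Eq.symm hi) hj
    simp only [Option.some.injEq, Prod.mk.injEq, and_true] at this
    exact hk this
  refine hπ.norm_sum_single_le (fun i => t (k i)) (S true) (S false) (hS _) (hS _)
    (fun i g hg => ?_) hp
  have h1 : (τ (t (k i) * g)⁻¹)⁻¹ = FreeGroup.of (k i) * (τ g⁻¹)⁻¹ := by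
    have := hτ g⁻¹ (FreeGroup.of (k i))⁻¹
    rw [map_inv, FreeGroup.lift_apply_of] at this
    rw [mul_inv_rev, this, mul_inv_rev, inv_inv]
  change (τ (t (k i) * g)⁻¹)⁻¹.toWord.head? = _
  rw [h1]
  exact FreeGroup.head_toWord_of_mul hg

/-- Each generator `k i ≠ i₀` contributes a double sum of `star (P.coeff a) * P.coeff b * r ^ (a + 1
+ b)`, which factors as `r * ‖P(r)‖ ^ 2`. -/
theorem inner_star_mul_sum_mul {β ι : Type} [Fintype ι] [DecidableEq β] (f : FreeGroup β →* Γ)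
    {π : UnitaryRep.{u, v} Γ} {ξ : π.space} {r : ℝ}
    (h : ∀ s, inner ℂ ξ (π.op (f s) ξ) = (r : ℂ) ^ s.norm) (i₀ : β) (k : ι → β)
    (hk : ∀ i, i₀ ≠ k i) (P : Polynomial ℂ) (y : MonoidAlgebra ℂ Γ)
    (hy : y = Polynomial.aeval (MonoidAlgebra.single (f (FreeGroup.of i₀)) (1 : ℂ)) P) :
    inner ℂ ξ (π.onGroupRing (star y *
        (∑ i, MonoidAlgebra.single (f (FreeGroup.of (k i))) (1 : ℂ)) * y) ξ) =
      (((Fintype.card ι : ℝ) * (r * ‖P.eval (r : ℂ)‖ ^ 2) : ℝ) : ℂ) := by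
  set a := f (FreeGroup.of i₀) with ha
  have hP : ∑ i ∈ Finset.range (P.natDegree + 1), P.coeff i * (r : ℂ) ^ i = P.eval (r : ℂ) :=
    (Polynomial.eval_eq_sum_range _).symm
  have hone : ∀ l : β, i₀ ≠ l →
      inner ℂ (Polynomial.aeval (π.op a) P ξ)
        (π.op (f (FreeGroup.of l)) (Polynomial.aeval (π.op a) P ξ)) =
      ((r * ‖P.eval (r : ℂ)‖ ^ 2 : ℝ) : ℂ) := by
    intro l hl
    have hij : ∀ i j : ℕ, (inner ℂ (π.op (a ^ i) ξ)
        (π.op (f (FreeGroup.of l)) (π.op (a ^ j) ξ)) : ℂ) = (r : ℂ) ^ i * (r * (r : ℂ) ^ j) := by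
      intro i j
      rw [inner_op_left, ← op_mul_apply, ← op_mul_apply, ha, ← map_pow, ← map_pow, ← map_inv,
        ← map_mul, ← map_mul, h, mul_assoc, FreeGroup.norm_of_pow_inv_mul_of_mul_of_pow hl]
      ring
    rw [aeval_op_apply, map_sum, sum_inner]
    simp only [inner_sum, map_smul, inner_smul_left, inner_smul_right, hij]
    have hc : ∑ i ∈ Finset.range (P.natDegree + 1), star (P.coeff i) * (r : ℂ) ^ i =
        star (P.eval (r : ℂ)) := by
      rw [← hP]; simp
    calc _ = (∑ i ∈ Finset.range (P.natDegree + 1), star (P.coeff i) * (r : ℂ) ^ i) * (r *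
          ∑ j ∈ Finset.range (P.natDegree + 1), P.coeff j * (r : ℂ) ^ j) := by
          simp only [Finset.mul_sum, Finset.sum_mul]
          rw [Finset.sum_comm]
          refine Finset.sum_congr rfl fun i _ => Finset.sum_congr rfl fun j _ => ?_
          simp only [starRingEnd_apply]
          ring
      _ = _ := by
          rw [hc, hP, mul_left_comm]
          push_cast
          rw [← Complex.conj_mul']
          rfl
  rw [map_mul, map_mul, π.onGroupRing_star, hy, onGroupRing_aeval_single]
  change inner ℂ ξ (star (Polynomial.aeval (π.op a) P) (π.onGroupRing _
    (Polynomial.aeval (π.op a) P ξ))) = _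
  rw [ContinuousLinearMap.star_eq_adjoint, ContinuousLinearMap.adjoint_inner_right, map_sum,
    sum_apply, inner_sum]
  simp only [onGroupRing_single, one_smul, hone _ (hk _)]
  simp

end UnitaryRep

/-! ### Comparison of growth rates and conclusion -/

open Filter in
theorem exists_growth_gap (P : Polynomial ℂ) (hP : P.eval 0 ≠ 0) {p q : ℝ} (hp : 0 < p)
    (hpq : p < q) (C : ℝ) : ∃ n : ℕ, 0 < n ∧
      C * (n : ℝ) ^ (1 - 1 / p) <
        n * ((5 * n : ℝ) ^ (-(1 / q)) * ‖P.eval (((5 * n : ℝ) ^ (-(1 / q)) : ℝ) : ℂ)‖ ^ 2) := by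
  have hq : 0 < q := hp.trans hpq
  have hr : Tendsto (fun n : ℕ => (5 * n : ℝ) ^ (-(1 / q))) atTop (nhds 0) :=
    (tendsto_rpow_neg_atTop (show 0 < 1 / q by positivity)).comp
      (tendsto_natCast_atTop_atTop.const_mul_atTop (by norm_num))
  have hPr : Tendsto (fun n : ℕ => (5 : ℝ) ^ (-(1 / q)) *
      ‖P.eval (((5 * n : ℝ) ^ (-(1 / q)) : ℝ) : ℂ)‖ ^ 2) atTop
      (nhds ((5 : ℝ) ^ (-(1 / q)) * ‖P.eval ((0 : ℝ) : ℂ)‖ ^ 2)) := by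
    have hc : Continuous fun x : ℝ => (5 : ℝ) ^ (-(1 / q)) * ‖P.eval (x : ℂ)‖ ^ 2 := by
      have := P.continuous.comp Complex.continuous_ofReal
      exact continuous_const.mul (this.norm.pow 2)
    exact (hc.tendsto 0).comp hr
  have hpos : 0 < (5 : ℝ) ^ (-(1 / q)) * ‖P.eval ((0 : ℝ) : ℂ)‖ ^ 2 := by
    rw [Complex.ofReal_zero]
    have := norm_pos_iff.2 hP
    positivity
  have hn : Tendsto (fun n : ℕ => (n : ℝ) ^ (1 / p - 1 / q)) atTop atTop :=
    (tendsto_rpow_atTop (sub_pos.2 (one_div_lt_one_div_of_lt hp hpq))).comp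
      tendsto_natCast_atTop_atTop
  obtain ⟨n, h1, h2⟩ := ((hn.atTop_mul_pos hpos hPr).eventually_gt_atTop C |>.and
    (eventually_gt_atTop 0)).exists
  refine ⟨n, h2, ?_⟩
  have hn0 : (0 : ℝ) < n := Nat.cast_pos.2 h2
  -- The surplus `n ^ (1/p - 1/q)` tends to infinity, while the remaining factor tends to a positive
  -- multiple of `‖P(0)‖ ^ 2`.
  have hn1 : (n : ℝ) * (n : ℝ) ^ (-(1 / q)) = n ^ (1 / p - 1 / q) * n ^ (1 - 1 / p) := by
    rw [← Real.rpow_add hn0]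
    nth_rw 1 [← Real.rpow_one (n : ℝ)]
    rw [← Real.rpow_add hn0]
    congr 1; ring
  calc C * (n : ℝ) ^ (1 - 1 / p) < (n : ℝ) ^ (1 / p - 1 / q) * ((5 : ℝ) ^ (-(1 / q)) *
        ‖P.eval (((5 * n : ℝ) ^ (-(1 / q)) : ℝ) : ℂ)‖ ^ 2) * (n : ℝ) ^ (1 - 1 / p) :=
        mul_lt_mul_of_pos_right h1 (by positivity)
    _ = (n * (n : ℝ) ^ (-(1 / q))) * ((5 : ℝ) ^ (-(1 / q)) *
      ‖P.eval (((5 * n : ℝ) ^ (-(1 / q)) : ℝ) : ℂ)‖ ^ 2) := by rw [hn1]; ring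
    _ = _ := by rw [Real.mul_rpow (by norm_num) hn0.le]; ring

theorem mainTheorem9 {Γ : Type u} [Group Γ]
    (hfree : ∃ f : FreeGroup (Fin 2) →* Γ, Function.Injective f)
    (F₀ : Set (UnitaryRep.{u, v} Γ)) (hfin : F₀.Finite) (hne : F₀.Nonempty)
    (hfd : ∀ π ∈ F₀, FiniteDimensional ℂ π.space)
    (p q : ℝ) (hp : 2 ≤ p) (hpq : p < q) :
    ¬ cstarEllP Γ q ≤ cstarOfReps F₀ ⊔ cstarEllP Γ p := by
  intro hle
  have hp0 : 0 < p := by linarith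
  have hq0 : 0 < q := hp0.trans hpq
  obtain ⟨f, hf⟩ := hfree
  obtain ⟨t, ht⟩ := exists_injective_lift_int f hf
  obtain ⟨P, hP0, hP⟩ := UnitaryRep.exists_annihilating_polynomial F₀ hfin hfd (t 0)
  set y : MonoidAlgebra ℂ Γ := Polynomial.aeval (MonoidAlgebra.single (t 0) (1 : ℂ)) P with hy
  set C : ℝ := y.coeff.sum fun _ a => ‖a‖ with hC
  have hC0 : 0 ≤ C := Finset.sum_nonneg fun _ _ => norm_nonneg _
  -- `C` bounds `y`, which involves only `t 0`, so it is fixed before `n`. The constant is `2` from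
  -- ping-pong times `C` on each side of `w`.
  obtain ⟨n, hn, hgap⟩ := exists_growth_gap P hP0 hp0 hpq (C * 2 * C)
  have hn0 : (0 : ℝ) < n := Nat.cast_pos.2 hn
  have : Nonempty (Fin n) := ⟨⟨0, hn⟩⟩
  -- The letter `none` is reserved for `t 0`, the generator in `y`; the others give `t 1, ..., t n`
  -- in `w`.
  let k : Option (Fin n) → ℤ := fun o => o.elim 0 fun i => (i : ℤ) + 1
  have hk : Function.Injective k := by
    rintro (_ | i) (_ | j) h
    · rfl
    · simp only [k, Option.elim] at h; omega
    · simp only [k, Option.elim] at h; omega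
    · simp only [k, Option.elim] at h
      congr 1; ext; omega
  let φ : FreeGroup (Option (Fin n)) →* Γ := (FreeGroup.lift t).comp (FreeGroup.map k)
  have hφ : Function.Injective φ := ht.comp (FreeGroup.map_injective hk)
  have hφof : ∀ o, φ (FreeGroup.of o) = t (k o) := fun o => by simp [φ]
  set w : MonoidAlgebra ℂ Γ := ∑ i : Fin n, MonoidAlgebra.single (t (k (some i))) (1 : ℂ) with hw
  have hF : (cstarOfReps F₀).normOn (star y * w * y) = 0 := by
    rw [cstarOfReps, GroupCStarAlgebra.normOn_ofSeminorm]
    change (⨆ π : F₀, ‖π.1.onGroupRing (star y * w * y)‖) = 0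
    have : ∀ π : F₀, ‖π.1.onGroupRing (star y * w * y)‖ = 0 := fun π => by
      rw [map_mul, hy, UnitaryRep.onGroupRing_aeval_single, hP π.1 π.2, mul_zero, norm_zero]
    simp only [this, Real.iSup_const_zero]
  have hup : (cstarEllP Γ p).normOn (star y * w * y) ≤ C * 2 * C * (n : ℝ) ^ (1 - 1 / p) := by
    rw [cstarEllP, cstarIdeal, cstarOfReps, GroupCStarAlgebra.normOn_ofSeminorm]
    refine Real.iSup_le (fun π => ?_) (by positivity)
    have h1 := UnitaryRep.norm_sum_free_generators_le t ht (fun i : Fin n => k (some i))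
      (fun i j h => Option.some.inj (hk h)) hp π.2
    have h2 : ‖π.1.onGroupRing y‖ ≤ C := π.1.norm_onGroupRing_le y
    rw [Fintype.card_fin] at h1
    rw [map_mul, map_mul, π.1.onGroupRing_star]
    calc _ ≤ ‖star (π.1.onGroupRing y)‖ * ‖π.1.onGroupRing w‖ * ‖π.1.onGroupRing y‖ :=
          (norm_mul_le _ _).trans (by gcongr; exact norm_mul_le _ _)
      _ ≤ C * (2 * (n : ℝ) ^ (1 - 1 / p)) * C := by
          rw [norm_star]; gcongr
      _ = _ := by ring
  set r : ℝ := (5 * n : ℝ) ^ (-(1 / q)) with hr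
  have hr0 : 0 ≤ r := by positivity
  have hn1 : (1 : ℝ) ≤ n := Nat.one_le_cast.2 hn
  have hr1 : r ≤ 1 := Real.rpow_le_one_of_one_le_of_nonpos (by linarith)
    (neg_nonpos.2 (by positivity))
  -- The rank is `n + 1`, so the quantity is `2(n+1)/(5n) ≤ 4/5`; this is why `r` contains `5n`.
  have hrq : 2 * (Fintype.card (Option (Fin n)) : ℝ) * r ^ q < 1 := by
    rw [hr, ← Real.rpow_mul (by positivity), neg_mul, one_div_mul_cancel hq0.ne',
      Real.rpow_neg_one, Fintype.card_option, Fintype.card_fin, ← div_eq_mul_inv,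
      div_lt_one (by positivity)]
    push_cast
    linarith
  obtain ⟨π, ξ, hπ, hξ⟩ := UnitaryRep.exists_isDRep_of_free φ hφ hq0 hr0 hr1 hrq
  have hlow : (n : ℝ) * (r * ‖P.eval (r : ℂ)‖ ^ 2) ≤ (cstarEllP Γ q).normOn (star y * w * y) := by
    have hin := UnitaryRep.inner_star_mul_sum_mul φ hξ none (fun i : Fin n => some i)
      (fun i => by simp) P y (by rw [hφof]; rfl)
    simp only [hφof] at hin
    have hξ1 : ‖ξ‖ = 1 := by
      have := hξ 1
      rw [map_one, UnitaryRep.op_one, FreeGroup.norm_one, pow_zero] at this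
      change inner ℂ ξ ξ = (1 : ℂ) at this
      rw [inner_self_eq_norm_sq_to_K] at this
      have h2 : ‖ξ‖ ^ 2 = 1 := Complex.ofReal_injective (by simpa using this)
      exact (pow_eq_one_iff_of_nonneg (norm_nonneg _) two_ne_zero).1 h2
    rw [cstarEllP, cstarIdeal, cstarOfReps, GroupCStarAlgebra.normOn_ofSeminorm]
    refine le_trans ?_ (le_ciSup (UnitaryRep.bddAbove_norm_onGroupRing _ (star y * w * y))
      (⟨π, hπ⟩ : {π : UnitaryRep.{u, u} Γ | π.IsDRep (ellP Γ q)}))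
    calc (n : ℝ) * (r * ‖P.eval (r : ℂ)‖ ^ 2)
        = ‖(inner ℂ ξ (π.onGroupRing (star y * w * y) ξ) : ℂ)‖ := by
          rw [hin, Complex.norm_real, Fintype.card_fin, Real.norm_of_nonneg (by positivity)]
      _ ≤ ‖ξ‖ * ‖π.onGroupRing (star y * w * y) ξ‖ := norm_inner_le_norm _ _
      _ ≤ ‖ξ‖ * (‖π.onGroupRing (star y * w * y)‖ * ‖ξ‖) := by
          gcongr; exact ContinuousLinearMap.le_opNorm _ _
      _ = _ := by rw [hξ1]; ring
  have hmax : (cstarOfReps F₀ ⊔ cstarEllP Γ p).normOn (star y * w * y) ≤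
      C * 2 * C * (n : ℝ) ^ (1 - 1 / p) := by
    change (GroupCStarAlgebra.ofSeminorm _).normOn _ ≤ _
    rw [GroupCStarAlgebra.normOn_ofSeminorm]
    exact max_le (hF.trans_le (by positivity)) hup
  exact absurd ((hlow.trans (hle _)).trans hmax) (not_le.2 hgap)
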